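/- Write $\mathcal B(r)=\{x\in\mathbb R^3:\|x\|<r\}$ and $\widehat g(z)=\int_{\mathbb R^3}e^{ix\cdot z}g(x)\,dx$ for $g\in L^1(\mathbb R^3)$. For two functions $A,B$ on a set $S$, write $A\asymp B$ on $S$ if there is a finite constant $c>1$ with $A\le cB$ and $B\le cA$ on $S$. A correlation function is a locally integrable function $f:\mathbb R^3\to(0,\infty)$ that is a tempered distribution with nonnegative Fourier transform. Theorem. For every $\alpha>1$ there is a correlation function $f:\mathbb R^3\to(0,\infty)$, with $f\in L^1(\mathbb R^3)$, such that: 1. $f>0$ and $\widehat f>0$ everywhere on $\mathbb R^3$ (in particular, $\widehat f$ is real-valued); 2. $f$ is uniformly continuous on $\mathbb R^3\setminus\mathcal B(r)$ for every $r>0$; 3. there is a function $\varphi:[0,\infty)\to[0,\infty)$, nonincreasing on $(0,\infty)$, such that $f(x)=\varphi(\|x\|)$ for all $x\in\mathbb R^3$; 4. $f(x)\asymp\|x\|^{-2}\,[\log(1/\|x\|)]^{-\alpha}$ on $\mathcal B(1/e)\setminus\{0\}$; 5. $\widehat f(z)\asymp\|z\|^{-1}\,[\log\|z\|]^{-\alpha}$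 on $\mathbb R^3\setminus\mathcal B(e)$; 6. $f$ satisfies Dalang's condition $\displaystyle\int_{\mathbb R^3}\frac{\widehat f(z)}{1+\|z\|^2}\,dz<\infty$. Moreover, $f$ can be chosen of the form $$f(x)=\int_{(0,\infty)}p_s(x)\,U(ds)\qquad(x\in\mathbb R^3\setminus\{0\}),\qquad p_s(x)=(2\pi s)^{-3/2}e^{-\|x\|^2/(2s)},$$ where $U(A)=\int_0^\infty\mathrm P\{T_t\in A\}\,e^{-t}\,dt$ is the 1-potential measure of some subordinator $T=\{T_t\}_{t\ge0}$, that is, of a process with $T_0=0$ a.s., stationary and independent increments, and a.s. nondecreasing right-continuous paths. -/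

import Mathlib

open MeasureTheory ProbabilityTheory Set
open scoped NNReal ENNReal

noncomputable section

/-- Three-dimensional Euclidean space. -/
abbrev E3 : Type := EuclideanSpace ℝ (Fin 3)

/-- The heat kernel `p_t(x) = (2πt)^{-3/2} exp(-‖x‖² / (2t))` in `ℝ³` (used for `t > 0` only). -/
def heatKernel (t : ℝ) (x : E3) : ℝ :=
  (2 * Real.pi * t) ^ (-(3 / 2) : ℝ) * Real.exp (-‖x‖ ^ 2 / (2 * t))

/-- The Fourier transform `ĝ(z) = ∫ e^{i x·z} g(x) dx` of an integrable function `g`. -/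
def fourierR3 (g : E3 → ℝ) (z : E3) : ℂ :=
  ∫ x : E3, Complex.exp (Complex.I * ((inner ℝ x z : ℝ) : ℂ)) * (g x : ℂ)

/-- A correlation function: a strictly positive, locally integrable function on `ℝ³` that defines
a tempered distribution whose (distributional) Fourier transform `ψ ↦ ∫ f ψ̂` is nonnegative, that
is, it is nonnegative on every nonnegative Schwartz function `ψ`. -/
structure IsCorrelationFunction (f : E3 → ℝ) : Prop where
  pos : ∀ x, 0 < f x
  locallyIntegrable : LocallyIntegrable f volume
  tempered : ∀ ψ : SchwartzMap E3 ℝ,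
    Integrable (fun x => (f x : ℂ) * fourierR3 ψ x) volume
  fourier_nonneg : ∀ ψ : SchwartzMap E3 ℝ, (∀ z, 0 ≤ ψ z) →
    (∫ x, (f x : ℂ) * fourierR3 ψ x).im = 0 ∧ 0 ≤ (∫ x, (f x : ℂ) * fourierR3 ψ x).re

/-- `A(r) ≲ B(r)` for all `r ∈ S`. -/
def LesssimOn {R : Type*} (S : Set R) (A B : R → ℝ) : Prop :=
  ∃ c : ℝ, 1 < c ∧ ∀ r ∈ S, A r ≤ c * B r

/-- `A(r) ≍ B(r)` for all `r ∈ S`. -/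
def AsympOn {R : Type*} (S : Set R) (A B : R → ℝ) : Prop :=
  LesssimOn S B A ∧ LesssimOn S A B

/-- A subordinator: a real-valued stochastic process started at `0` with stationary, independent
increments, whose paths are almost surely nondecreasing and right-continuous. -/
structure IsSubordinator {Ω : Type*} [MeasurableSpace Ω] (P : Measure Ω)
    (T : ℝ≥0 → Ω → ℝ) : Prop where
  measurable : ∀ t, Measurable (T t)
  zero : ∀ᵐ ω ∂P, T 0 ω = 0
  mono : ∀ᵐ ω ∂P, Monotone fun t => T t ω
  rightCts : ∀ᵐ ω ∂P, ∀ t, ContinuousWithinAt (fun s => T s ω) (Ici t) t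
  indep : HasIndepIncrements T P
  stationary : ∀ s t, IdentDistrib (fun ω => T (s + t) ω - T s ω) (T t) P P

/-- `U` is the 1-potential measure of the process `T`:
`U(A) = ∫₀^∞ P{T_t ∈ A} e^{-t} dt` for all Borel sets `A`. -/
def IsOnePotentialMeasure {Ω : Type*} [MeasurableSpace Ω] (P : Measure Ω)
    (T : ℝ≥0 → Ω → ℝ) (U : Measure ℝ) : Prop :=
  ∀ A : Set ℝ, MeasurableSet A →
    U A = ∫⁻ t : ℝ in Ioi 0, P {ω | T t.toNNReal ω ∈ A} * ENNReal.ofReal (Real.exp (-t))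

end

/-! If a subordinator has Laplace exponent `Φ`, its 1-potential measure `U` has Laplace transform `L
= 1 / (1 + Φ)`. Hence the mixture `f = ∫ p_s U(ds)` has Fourier transform `L(‖z‖² / 2)`, and the
behavior at infinity demands `Φ(q) ≍ √q (log q)^α`. This is arranged by hand: jumps of size `4⁻ᵏ` at
rate `2ᵏ (k + 1)^α`. For `4ᵐ ≤ q ≤ 4ᵐ⁺¹` the terms with `k ≤ m` add up geometrically and those with
`k > m` decay geometrically, so `Φ(q)` is comparable to its `m`-th rate (`laplaceExponent_asymp`).

Near the origin the point is `f(x) ≍ r⁻³ L(r⁻²)` with `r = ‖x‖`, a Tauberian statement made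
elementary by comparing `p_s` with exponentials in `s`. From above, `p_s ≤ C (s + r²)^(-3/2)`, which
is a Gamma mixture of exponentials, and `L` grows at most like `1/q` to the left of `r⁻²` because
`Φ` is concave (`exists_radialPotential_le`). From below, `p_s ≥ c r⁻³ (e⁻ᵗ - 2 e⁻ᴹᵗ)` with `t = s /
r²`, and for large `M` the growth of `Φ` makes the subtracted term harmless
(`exists_le_radialPotential`, `exists_laplaceExponent_dilate`).

The subordinator is built from independent Poisson cells, one for each unit time interval and each
jump size. Campbell's formula yields the joint exponential moments of its increments, and from these
independence, stationarity and the formula for `L` (`integral_exp_jumpProcess_increments`). Dalang's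
condition reduces to `∫ dr / (r (log r)^α) < ∞`. -/

noncomputable section

/-! ### Jump rates and the growth of the Laplace exponent -/

/-- The intensity `2 ^ k (k + 1) ^ α` of the jumps of size `4 ^ (-k)`. -/
def jumpRate (α : ℝ) (k : ℕ) : ℝ≥0 := 2 ^ k * ((k : ℝ≥0) + 1) ^ α

/-- The jump sizes `4 ^ (-k)`. -/
def jumpSize (k : ℕ) : ℝ := (4 ^ k)⁻¹

/-- The Laplace exponent of the pure jump subordinator with jumps of size `a k` at rate `lam k`. -/
def laplaceExponent (a : ℕ → ℝ) (lam : ℕ → ℝ≥0) (q : ℝ) : ℝ :=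
  ∑' k, (lam k : ℝ) * (1 - Real.exp (-(q * a k)))

lemma coe_jumpRate (α : ℝ) (k : ℕ) : (jumpRate α k : ℝ) = 2 ^ k * ((k : ℝ) + 1) ^ α := by
  simp [jumpRate]

lemma jumpSize_pos (k : ℕ) : 0 < jumpSize k := by
  unfold jumpSize; positivity

lemma summable_add_rpow_mul_half_pow (α : ℝ) (c : ℝ) (hc : 1 ≤ c) :
    Summable fun k : ℕ => ((k : ℝ) + c) ^ α * (1 / 2) ^ k := by
  have h1 : Summable fun k : ℕ => (((k : ℝ) + c) ^ ⌈|α|⌉₊) * (1 / 2) ^ k := by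
    have h := fun (j : ℕ) => summable_pow_mul_geometric_of_norm_lt_one j
      (r := (1 / 2 : ℝ)) (by norm_num)
    simp_rw [add_pow, Finset.sum_mul]
    refine summable_sum fun j _ => ?_
    refine ((h j).mul_left (c ^ (⌈|α|⌉₊ - j) * (⌈|α|⌉₊.choose j))).congr fun k => ?_
    ring
  refine Summable.of_nonneg_of_le (fun k => by positivity) (fun k => ?_) h1
  gcongr
  rw [← Real.rpow_natCast]
  refine Real.rpow_le_rpow_of_exponent_le ?_ ((le_abs_self α).trans (Nat.le_ceil _))
  have : (0 : ℝ) ≤ k := by positivity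
  linarith

lemma summable_jumpRate_mul_jumpSize (α : ℝ) :
    Summable fun k => (jumpRate α k : ℝ) * jumpSize k := by
  refine (summable_add_rpow_mul_half_pow α 1 le_rfl).congr fun k => ?_
  rw [coe_jumpRate, jumpSize, show (4 : ℝ) = 2 * 2 by norm_num, mul_pow]
  field_simp
  rw [← mul_pow]; norm_num

section
variable {a : ℕ → ℝ} {lam : ℕ → ℝ≥0}

lemma laplaceExponent_term_nonneg (ha : ∀ k, 0 < a k) {q : ℝ} (hq : 0 ≤ q) (k : ℕ) :
    0 ≤ (lam k : ℝ) * (1 - Real.exp (-(q * a k))) := by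
  refine mul_nonneg (by positivity) ?_
  have : Real.exp (-(q * a k)) ≤ 1 := by
    rw [Real.exp_le_one_iff]
    have := mul_nonneg hq (ha k).le
    linarith
  linarith

lemma laplaceExponent_term_le (q : ℝ) (k : ℕ) :
    (lam k : ℝ) * (1 - Real.exp (-(q * a k))) ≤ q * ((lam k : ℝ) * a k) := by
  have := Real.add_one_le_exp (-(q * a k))
  have h0 : (0 : ℝ) ≤ lam k := by positivity
  nlinarith

lemma summable_laplaceExponent (ha : ∀ k, 0 < a k) (hs : Summable fun k => (lam k : ℝ) * a k)
    {q : ℝ} (hq : 0 ≤ q) : Summable fun k => (lam k : ℝ) * (1 - Real.exp (-(q * a k))) :=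
  Summable.of_nonneg_of_le (laplaceExponent_term_nonneg ha hq)
    (laplaceExponent_term_le q) (hs.mul_left q)

lemma laplaceExponent_nonneg (ha : ∀ k, 0 < a k) {q : ℝ} (hq : 0 ≤ q) :
    0 ≤ laplaceExponent a lam q :=
  tsum_nonneg (laplaceExponent_term_nonneg ha hq)

/-- Bernoulli's inequality, applied to `e^(-R a) = (e^(-q a))^(R / q)` in each summand; this is
concavity of the exponent together with its vanishing at `0`. -/
lemma laplaceExponent_le_div_mul (ha : ∀ k, 0 < a k)
    (hs : Summable fun k => (lam k : ℝ) * a k) {q R : ℝ} (hq : 0 < q) (hR : q ≤ R) :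
    laplaceExponent a lam R ≤ R / q * laplaceExponent a lam q := by
  rw [laplaceExponent, laplaceExponent, ← tsum_mul_left]
  refine (summable_laplaceExponent ha hs (hq.le.trans hR)).tsum_le_tsum (fun k => ?_)
    ((summable_laplaceExponent ha hs hq.le).mul_left _)
  have h := one_add_mul_self_le_rpow_one_add (s := Real.exp (-(q * a k)) - 1)
    (by linarith [Real.exp_pos (-(q * a k))]) (p := R / q) ((one_le_div hq).2 hR)
  rw [add_sub_cancel, ← Real.exp_mul,
    show -(q * a k) * (R / q) = -(R * a k) by field_simp] at h
  have h0 : (0 : ℝ) ≤ lam k := by positivity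
  nlinarith

end

/-- The single term `k = m` suffices, since `q 4⁻ᵐ ≥ 1` there. -/
lemma laplaceExponent_lower (α : ℝ) {q : ℝ} {m : ℕ} (hm : 4 ^ m ≤ q) :
    (1 - Real.exp (-1)) * (2 ^ m * ((m : ℝ) + 1) ^ α) ≤
      laplaceExponent jumpSize (jumpRate α) q := by
  have hq : 0 ≤ q := le_trans (by positivity) hm
  refine le_trans ?_ ((summable_laplaceExponent jumpSize_pos
    (summable_jumpRate_mul_jumpSize α) hq).le_tsum m
      fun k _ => laplaceExponent_term_nonneg jumpSize_pos hq k)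
  rw [coe_jumpRate, mul_comm]
  gcongr
  rw [jumpSize]
  field_simp
  exact hm

lemma laplaceExponent_upper (α : ℝ) (hα : 0 < α) :
    ∃ C, 0 < C ∧ ∀ (m : ℕ) (q : ℝ), 0 ≤ q → q ≤ 4 ^ (m + 1) →
      laplaceExponent jumpSize (jumpRate α) q ≤ C * (2 ^ m * ((m : ℝ) + 1) ^ α) := by
  set D := ∑' j : ℕ, ((j : ℝ) + 2) ^ α * (1 / 2) ^ j with hD
  have hDs := summable_add_rpow_mul_half_pow α 2 (by norm_num)
  have hD0 : 0 ≤ D := tsum_nonneg fun j => by positivity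
  -- The `2` pays for the geometric sum over `k ≤ m`, the `2 * D` for the tail `k > m`, where `1 -
  -- e⁻ˣ ≤ x`.
  refine ⟨2 + 2 * D, by positivity, fun m q hq0 hq => ?_⟩
  have hsum := summable_laplaceExponent jumpSize_pos (summable_jumpRate_mul_jumpSize α) hq0
  rw [laplaceExponent, ← hsum.sum_add_tsum_nat_add (m + 1), add_mul]
  refine add_le_add ?_ ?_
  · calc ∑ k ∈ Finset.range (m + 1), (jumpRate α k : ℝ) * (1 - Real.exp (-(q * jumpSize k)))
        ≤ ∑ k ∈ Finset.range (m + 1), 2 ^ k * ((m : ℝ) + 1) ^ α := by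
          refine Finset.sum_le_sum fun k hk => ?_
          have hk' : (k : ℝ) ≤ m := by
            have := Finset.mem_range.1 hk
            exact_mod_cast Nat.lt_succ_iff.1 this
          rw [coe_jumpRate]
          calc _ ≤ 2 ^ k * ((k : ℝ) + 1) ^ α * 1 := by
                gcongr
                linarith [Real.exp_pos (-(q * jumpSize k))]
            _ ≤ _ := by rw [mul_one]; gcongr
      _ = (2 ^ (m + 1) - 1) * ((m : ℝ) + 1) ^ α := by
          rw [← Finset.sum_mul, geom_sum_eq (by norm_num)]; norm_num
      _ ≤ 2 * (2 ^ m * ((m : ℝ) + 1) ^ α) := by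
          rw [pow_succ]
          have : (0 : ℝ) ≤ ((m : ℝ) + 1) ^ α := by positivity
          nlinarith
  · rw [hD, ← tsum_mul_left, ← tsum_mul_right]
    refine ((summable_nat_add_iff (m + 1)).2 hsum).tsum_le_tsum (fun j => ?_)
      ((hDs.mul_left 2).mul_right _)
    refine (laplaceExponent_term_le q _).trans ?_
    rw [coe_jumpRate, jumpSize]
    -- Since `j + m + 2 ≤ (j + 2)(m + 1)`, the dependence on `m` factors out of the tail.
    have h1 : (((j + (m + 1) : ℕ) : ℝ) + 1) ^ α ≤ ((j : ℝ) + 2) ^ α * ((m : ℝ) + 1) ^ α := by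
      rw [← Real.mul_rpow (by positivity) (by positivity)]
      gcongr
      push_cast
      have hj : (0 : ℝ) ≤ j := by positivity
      have hm : (0 : ℝ) ≤ m := by positivity
      nlinarith
    calc q * (2 ^ (j + (m + 1)) * (((j + (m + 1) : ℕ) : ℝ) + 1) ^ α * (4 ^ (j + (m + 1)))⁻¹)
        ≤ 4 ^ (m + 1) * (2 ^ (j + (m + 1)) * (((j : ℝ) + 2) ^ α * ((m : ℝ) + 1) ^ α) *
            (4 ^ (j + (m + 1)))⁻¹) := by gcongr
      _ = 2 * (((j : ℝ) + 2) ^ α * (1 / 2) ^ j) * (2 ^ m * ((m : ℝ) + 1) ^ α) := by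
        rw [show (4 : ℝ) = 2 * 2 by norm_num]
        simp only [mul_pow, pow_add, pow_one, one_div, inv_pow]
        field_simp

lemma exp_one_le_three : Real.exp 1 ≤ 3 := by
  have := Real.exp_one_lt_d9
  linarith

/-- With `m` the integer part of `log q / log 4`, the size `2ᵐ` is `√q` up to a factor `2`, and `m +
1` is comparable to `log q`. The restriction `q ≥ 3` gives `log q ≥ 1`, so that additive constants
can be absorbed. -/
lemma laplaceExponent_asymp (α : ℝ) (hα : 0 < α) :
    ∃ c₁ c₂ : ℝ, 0 < c₁ ∧ 0 < c₂ ∧ ∀ q : ℝ, 3 ≤ q →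
      c₁ * (√q * Real.log q ^ α) ≤ 1 + laplaceExponent jumpSize (jumpRate α) q ∧
      1 + laplaceExponent jumpSize (jumpRate α) q ≤ c₂ * (√q * Real.log q ^ α) := by
  obtain ⟨C, hC, hup⟩ := laplaceExponent_upper α hα
  have h4 : (0 : ℝ) < Real.log 4 := Real.log_pos (by norm_num)
  have he : 0 < 1 - Real.exp (-1) := by
    have : Real.exp (-1) < 1 := by rw [Real.exp_lt_one_iff]; norm_num
    linarith
  set e := (1 - Real.exp (-1)) with hedef
  clear_value e
  refine ⟨e / 2 * (1 / Real.log 4) ^ α, 1 + C * (1 / Real.log 4 + 1) ^ α,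
    by positivity, by positivity, fun q hq => ?_⟩
  have hq0 : 0 < q := by linarith
  have hlog : 1 ≤ Real.log q := by
    rw [Real.le_log_iff_exp_le hq0]; exact exp_one_le_three.trans hq
  have hlog0 : 0 < Real.log q := by linarith
  set m := ⌊Real.log q / Real.log 4⌋₊ with hm
  have hm1 : (m : ℝ) ≤ Real.log q / Real.log 4 := Nat.floor_le (by positivity)
  have hm2 : Real.log q / Real.log 4 < m + 1 := Nat.lt_floor_add_one _
  have hq1 : (4 : ℝ) ^ m ≤ q := by
    rw [← Real.log_le_log_iff (by positivity) hq0, Real.log_pow]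
    rwa [le_div_iff₀ h4] at hm1
  have hq2 : q ≤ (4 : ℝ) ^ (m + 1) := by
    rw [← Real.log_le_log_iff hq0 (by positivity), Real.log_pow]
    rw [div_lt_iff₀ h4] at hm2
    push_cast
    exact hm2.le
  have hs4 : ∀ n : ℕ, √((4 : ℝ) ^ n) = 2 ^ n := fun n => by
    rw [show (4 : ℝ) = 2 ^ 2 by norm_num, ← pow_mul, mul_comm, pow_mul,
      Real.sqrt_sq (by positivity)]
  have hs1 : 2 ^ m ≤ √q := by rw [← hs4]; exact Real.sqrt_le_sqrt hq1
  have hs2 : √q ≤ 2 ^ (m + 1) := by rw [← hs4]; exact Real.sqrt_le_sqrt hq2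
  constructor
  · calc e / 2 * (1 / Real.log 4) ^ α * (√q * Real.log q ^ α)
        ≤ e / 2 * (1 / Real.log 4) ^ α * (2 ^ (m + 1) * Real.log q ^ α) := by gcongr
      _ = e * (2 ^ m * (1 / Real.log 4 * Real.log q) ^ α) := by
        rw [Real.mul_rpow (by positivity) hlog0.le, pow_succ]; ring
      _ ≤ e * (2 ^ m * ((m : ℝ) + 1) ^ α) := by
        gcongr
        rw [one_div_mul_eq_div]
        exact hm2.le
      _ ≤ _ := by
        have := laplaceExponent_lower α hq1
        rw [← hedef] at this
        linarith
  · have h1 : 1 ≤ √q * Real.log q ^ α := by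
      have : 1 ≤ √q := by rw [Real.one_le_sqrt]; linarith
      have : 1 ≤ Real.log q ^ α := Real.one_le_rpow hlog hα.le
      nlinarith
    have h2 := hup m q hq0.le hq2
    calc 1 + laplaceExponent jumpSize (jumpRate α) q
        ≤ √q * Real.log q ^ α + C * (√q * ((1 / Real.log 4 + 1) * Real.log q) ^ α) := by
          refine add_le_add h1 (h2.trans ?_)
          gcongr
          rw [add_mul, one_div_mul_eq_div]
          linarith
      _ = _ := by
        rw [Real.mul_rpow (by positivity) hlog0.le]; ring

/-- Dilation by `M` multiplies `√q` by `√M`, which beats the ratio of the two comparison constants.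
The factor `4` leaves room for the coefficient `2` in `exists_mul_exp_sub_le`. -/
lemma exists_laplaceExponent_dilate (α : ℝ) (hα : 0 < α) :
    ∃ M : ℝ, 1 < M ∧ ∀ q, 3 ≤ q → 4 * (1 + laplaceExponent jumpSize (jumpRate α) q) ≤
      1 + laplaceExponent jumpSize (jumpRate α) (M * q) := by
  obtain ⟨c₁, c₂, h1, h2, h⟩ := laplaceExponent_asymp α hα
  refine ⟨(4 * c₂ / c₁ + 2) ^ 2, ?_, fun q hq => ?_⟩
  · have : 0 < 4 * c₂ / c₁ := by positivity
    nlinarith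
  set K := 4 * c₂ / c₁ with hK
  have hK0 : 0 < K := by positivity
  have hM : 1 ≤ (K + 2) ^ 2 := by nlinarith
  have hqM : q ≤ (K + 2) ^ 2 * q := by nlinarith
  have hlog : 0 ≤ Real.log q := Real.log_nonneg (by linarith)
  calc 4 * (1 + laplaceExponent jumpSize (jumpRate α) q)
      ≤ 4 * (c₂ * (√q * Real.log q ^ α)) := by gcongr; exact (h q hq).2
    _ = c₁ * (K * √q * Real.log q ^ α) := by rw [hK]; field_simp
    _ ≤ c₁ * ((K + 2) * √q * Real.log ((K + 2) ^ 2 * q) ^ α) := by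
      gcongr
      linarith
    _ = c₁ * (√((K + 2) ^ 2 * q) * Real.log ((K + 2) ^ 2 * q) ^ α) := by
      rw [Real.sqrt_mul (by positivity), Real.sqrt_sq (by positivity)]
    _ ≤ _ := (h _ (hq.trans hqM)).1

lemma tendsto_laplaceExponent_atTop (α : ℝ) (hα : 0 < α) :
    Filter.Tendsto (laplaceExponent jumpSize (jumpRate α)) Filter.atTop Filter.atTop := by
  obtain ⟨c₁, c₂, h1, h2, h⟩ := laplaceExponent_asymp α hα
  have ht : Filter.Tendsto (fun q : ℝ => c₁ * √q + -1) Filter.atTop Filter.atTop :=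
    Filter.tendsto_atTop_add_const_right _ _ (Real.tendsto_sqrt_atTop.const_mul_atTop h1)
  refine Filter.tendsto_atTop_mono' _ ?_ ht
  filter_upwards [Filter.eventually_ge_atTop 3] with q hq
  have hlog : 1 ≤ Real.log q ^ α := Real.one_le_rpow (by
    rw [Real.le_log_iff_exp_le (by linarith)]; exact exp_one_le_three.trans hq) hα.le
  have hm : c₁ * (√q * 1) ≤ c₁ * (√q * Real.log q ^ α) := by gcongr
  have := (h q hq).1
  linarith

/-! ### Poisson cells and Campbell's formula -/

instance isProbabilityMeasure_restrict_Ioc_add_one (x : ℝ) :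
    IsProbabilityMeasure ((volume : Measure ℝ).restrict (Ioc x (x + 1))) :=
  ⟨by simp⟩

/-- The law of a Poisson number of mean `r`, together with a sequence of independent uniform points
of `(x, x + 1]`. -/
def cellLaw (r : ℝ≥0) (x : ℝ) : Measure (ℕ × (ℕ → ℝ)) :=
  (poissonMeasure r).prod (Measure.infinitePi fun _ : ℕ => volume.restrict (Ioc x (x + 1)))

instance (r : ℝ≥0) (x : ℝ) : IsProbabilityMeasure (cellLaw r x) := by
  unfold cellLaw; infer_instance

/-- The sum of `h` over the first `p.1` points of the sequence `p.2`. -/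
def cellSum {E : Type*} [AddCommMonoid E] (h : ℝ → E) (p : ℕ × (ℕ → ℝ)) : E :=
  ∑ j ∈ Finset.range p.1, h (p.2 j)

lemma measurable_cellSum {E : Type*} [AddCommMonoid E] [MeasurableSpace E] [MeasurableAdd₂ E]
    {h : ℝ → E} (hh : Measurable h) : Measurable (cellSum h) := by
  refine measurable_from_prod_countable_right fun n => ?_
  simp only [cellSum]
  fun_prop

lemma integral_prod_infinitePi {φ : ℝ → ℂ} (hφ : Measurable φ) (ν : Measure ℝ)
    [IsProbabilityMeasure ν] (m : ℕ) :
    ∫ u, ∏ j ∈ Finset.range m, φ (u j) ∂(Measure.infinitePi fun _ : ℕ => ν) =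
      (∫ x, φ x ∂ν) ^ m := by
  have h := ((iIndepFun_infinitePi (P := fun _ : ℕ => ν) (X := fun _ => φ)
    (fun _ => hφ)).precomp (g := fun i : Fin m => (i : ℕ))
      Fin.val_injective).integral_fun_prod_eq_prod_integral
      (fun i => (by fun_prop : Measurable fun u : ℕ → ℝ => φ (u i)).aestronglyMeasurable)
  have h2 : ∀ i : ℕ, ∫ u : ℕ → ℝ, φ (u i) ∂(Measure.infinitePi fun _ : ℕ => ν) = ∫ x, φ x ∂ν := by
    intro i
    conv_rhs => rw [← (measurePreserving_eval_infinitePi (fun _ : ℕ => ν) i).map_eq]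
    rw [integral_map (measurable_pi_apply i).aemeasurable hφ.aestronglyMeasurable]
  simp_rw [Finset.prod_range]
  rw [h]
  simp [h2]

/-- Given `n` points the mean is `cⁿ`, with `c` the mean of `φ` over the cell; the Poisson
generating function then gives `e^(r (c - 1))`. -/
lemma integral_cellLaw_prod {φ : ℝ → ℂ} (hφ : Measurable φ) (hb : ∀ u, ‖φ u‖ ≤ 1)
    (r : ℝ≥0) (x : ℝ) :
    ∫ p, ∏ j ∈ Finset.range p.1, φ (p.2 j) ∂(cellLaw r x) =
      Complex.exp (r * ((∫ u in Ioc x (x + 1), φ u) - 1)) := by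
  have hm : Measurable fun p : ℕ × (ℕ → ℝ) => ∏ j ∈ Finset.range p.1, φ (p.2 j) :=
    measurable_from_prod_countable_right fun n => by dsimp only; fun_prop
  have hi : Integrable (fun p : ℕ × (ℕ → ℝ) => ∏ j ∈ Finset.range p.1, φ (p.2 j))
      (cellLaw r x) := by
    refine Integrable.of_bound hm.aestronglyMeasurable 1 (.of_forall fun p => ?_)
    rw [norm_prod]
    exact Finset.prod_le_one (fun _ _ => norm_nonneg _) fun _ _ => hb _
  unfold cellLaw at hi ⊢
  rw [integral_prod _ hi]
  simp only [integral_prod_infinitePi hφ]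
  rw [integral_poissonMeasure]
  set c := ∫ u in Ioc x (x + 1), φ u
  calc ∑' n : ℕ, (Real.exp (-r) * r ^ n / n.factorial) • c ^ n
      = ∑' n : ℕ, (Real.exp (-r) : ℂ) * ((r * c) ^ n / n.factorial) := by
        congr with n
        rw [Complex.real_smul]
        push_cast
        rw [mul_pow]
        ring
    _ = Complex.exp (r * (c - 1)) := by
        rw [tsum_mul_left, (NormedSpace.expSeries_div_hasSum_exp ((r : ℂ) * c)).tsum_eq,
          ← Complex.exp_eq_exp_ℂ, Complex.ofReal_exp, ← Complex.exp_add]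
        push_cast
        ring_nf

lemma integral_exp_cellSum {g : ℝ → ℂ} (hg : Measurable g) (hre : ∀ u, (g u).re ≤ 0)
    (r : ℝ≥0) (x : ℝ) :
    ∫ p, Complex.exp (cellSum g p) ∂(cellLaw r x) =
      Complex.exp (r * (∫ u in Ioc x (x + 1), (Complex.exp (g u) - 1))) := by
  have hb : ∀ u, ‖Complex.exp (g u)‖ ≤ 1 := fun u => by
    rw [Complex.norm_exp]; exact Real.exp_le_one_iff.2 (hre u)
  have hi : Integrable (fun u => Complex.exp (g u)) (volume.restrict (Ioc x (x + 1))) :=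
    Integrable.of_bound (by fun_prop) 1 (.of_forall hb)
  rw [integral_sub hi (integrable_const _)]
  simp only [cellSum, Complex.exp_sum]
  rw [integral_cellLaw_prod (by fun_prop) hb]
  simp

/-- The sample space carrying, for all time cells and jump sizes, the corresponding points. -/
abbrev JumpSpace : Type := ℕ × ℕ → ℕ × (ℕ → ℝ)

/-- The law of independent Poisson cells: the cell `(n, k)` has intensity `lam k` on
`(n, n + 1]`. -/
def jumpLaw (lam : ℕ → ℝ≥0) : Measure JumpSpace :=
  Measure.infinitePi fun i : ℕ × ℕ => cellLaw (lam i.2) i.1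

instance (lam : ℕ → ℝ≥0) : IsProbabilityMeasure (jumpLaw lam) := by
  unfold jumpLaw; infer_instance

lemma integral_exp_sum_cellSum {lam : ℕ → ℝ≥0} {g : ℕ × ℕ → ℝ → ℂ} (hg : ∀ i, Measurable (g i))
    (hre : ∀ i u, (g i u).re ≤ 0) (F : Finset (ℕ × ℕ)) :
    ∫ ω, Complex.exp (∑ i ∈ F, cellSum (g i) (ω i)) ∂(jumpLaw lam) =
      Complex.exp (∑ i ∈ F, (lam i.2 : ℂ) *
        ∫ u in Ioc (i.1 : ℝ) (i.1 + 1), (Complex.exp (g i u) - 1)) := by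
  have hm : ∀ i, Measurable fun p => Complex.exp (cellSum (g i) p) := fun i =>
    (measurable_cellSum (hg i)).cexp
  have h := ((iIndepFun_infinitePi (P := fun i : ℕ × ℕ => cellLaw (lam i.2) i.1)
    (X := fun i p => Complex.exp (cellSum (g i) p)) hm).precomp (g := fun i : F => (i : ℕ × ℕ))
      Subtype.val_injective).integral_fun_prod_eq_prod_integral
      (fun i => ((hm i).comp (measurable_pi_apply _)).aestronglyMeasurable)
  simp only [Complex.exp_sum]
  simp_rw [← Finset.prod_coe_sort F]
  unfold jumpLaw
  rw [h]
  refine Finset.prod_congr rfl fun i _ => ?_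
  rw [← integral_exp_cellSum (hg i) (hre i)]
  rw [← (measurePreserving_eval_infinitePi
    (fun i : ℕ × ℕ => cellLaw (lam i.2) i.1) (i : ℕ × ℕ)).map_eq, integral_map
      (measurable_pi_apply _).aemeasurable ((hm i).aestronglyMeasurable)]

/-- Campbell's formula for the exponential functional of the Poisson cells. -/
lemma integral_exp_of_hasSum_cellSum {lam : ℕ → ℝ≥0} {g : ℕ × ℕ → ℝ → ℂ}
    (hg : ∀ i, Measurable (g i)) (hre : ∀ i u, (g i u).re ≤ 0) {S : JumpSpace → ℂ} {L : ℂ}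
    (hS : ∀ᵐ ω ∂jumpLaw lam, HasSum (fun i => cellSum (g i) (ω i)) (S ω))
    (hL : HasSum (fun i : ℕ × ℕ => (lam i.2 : ℂ) *
        ∫ u in Ioc (i.1 : ℝ) (i.1 + 1), (Complex.exp (g i u) - 1)) L) :
    ∫ ω, Complex.exp (S ω) ∂(jumpLaw lam) = Complex.exp L := by
  have h1 : Filter.Tendsto (fun F : Finset (ℕ × ℕ) =>
      ∫ ω, Complex.exp (∑ i ∈ F, cellSum (g i) (ω i)) ∂(jumpLaw lam)) Filter.atTop
      (nhds (∫ ω, Complex.exp (S ω) ∂(jumpLaw lam))) := by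
    -- All exponents have nonpositive real part, so every partial exponential is bounded by `1`.
    refine tendsto_integral_filter_of_dominated_convergence (fun _ => 1)
      (.of_forall fun F => ?_) (.of_forall fun F => .of_forall fun ω => ?_)
      (integrable_const _) ?_
    · refine (Measurable.cexp (Finset.measurable_fun_sum _ fun i _ => ?_)).aestronglyMeasurable
      exact (measurable_cellSum (hg i)).comp (measurable_pi_apply i)
    · rw [Complex.norm_exp, Real.exp_le_one_iff, Complex.re_sum]
      refine Finset.sum_nonpos fun i _ => ?_
      rw [cellSum, Complex.re_sum]
      exact Finset.sum_nonpos fun j _ => hre _ _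
    · filter_upwards [hS] with ω hω
      exact (Complex.continuous_exp.tendsto _).comp hω
  refine tendsto_nhds_unique h1 ?_
  simp_rw [integral_exp_sum_cellSum hg hre]
  exact (Complex.continuous_exp.tendsto _).comp hL

/-! ### The jump process and its paths -/

/-- The number of points in `(-∞, t]` of a Poisson cell. -/
def cellCount (t : ℝ) (p : ℕ × (ℕ → ℝ)) : ℝ := cellSum ((Iic t).indicator fun _ => (1 : ℝ)) p

/-- The pure jump process whose jumps of size `a k` occur at the points of the cells `(n, k)`. -/
def jumpProcess (a : ℕ → ℝ) (t : ℝ) (ω : JumpSpace) : ℝ :=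
  (∑' i : ℕ × ℕ, ENNReal.ofReal (a i.2 * cellCount t (ω i))).toReal

/-- The samples with all points in their cells and summable jumps on bounded time intervals. -/
def IsRegularSample (a : ℕ → ℝ) (ω : JumpSpace) : Prop :=
  (∀ i j, (ω i).2 j ∈ Ioc (i.1 : ℝ) (i.1 + 1)) ∧
    ∀ N : ℕ, Summable fun i : ℕ × ℕ => if i.1 < N then a i.2 * (ω i).1 else 0

lemma cellCount_nonneg (t : ℝ) (p : ℕ × (ℕ → ℝ)) : 0 ≤ cellCount t p := by
  unfold cellCount cellSum
  exact Finset.sum_nonneg fun _ _ => indicator_nonneg (fun _ _ => zero_le_one) _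

lemma cellCount_le (t : ℝ) (p : ℕ × (ℕ → ℝ)) : cellCount t p ≤ p.1 := by
  unfold cellCount cellSum
  calc _ ≤ ∑ j ∈ Finset.range p.1, (1 : ℝ) :=
        Finset.sum_le_sum fun _ _ => indicator_le_self' (fun _ _ => zero_le_one) _
    _ = p.1 := by simp

lemma cellCount_mono {s t : ℝ} (h : s ≤ t) (p : ℕ × (ℕ → ℝ)) : cellCount s p ≤ cellCount t p := by
  unfold cellCount cellSum
  exact Finset.sum_le_sum fun _ _ =>
    indicator_le_indicator_of_subset (Iic_subset_Iic.2 h) (fun _ => zero_le_one) _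

lemma cellCount_eq_zero {t : ℝ} {p : ℕ × (ℕ → ℝ)} (h : ∀ j, t < p.2 j) : cellCount t p = 0 := by
  unfold cellCount cellSum
  exact Finset.sum_eq_zero fun j _ => indicator_of_notMem (by simpa using h j) _

lemma cellCount_sub_cellCount {s t : ℝ} (h : s ≤ t) (p : ℕ × (ℕ → ℝ)) :
    cellCount t p - cellCount s p = cellSum ((Ioc s t).indicator fun _ => (1 : ℝ)) p := by
  rw [cellCount, cellCount, cellSum, cellSum, cellSum, ← Finset.sum_sub_distrib]
  refine Finset.sum_congr rfl fun j _ => ?_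
  simp only [indicator_apply, mem_Iic, mem_Ioc]
  split_ifs <;> grind

lemma measurable_cellCount : Measurable fun q : ℝ × (ℕ × (ℕ → ℝ)) => cellCount q.1 q.2 := by
  have h : Measurable fun q : ℕ × (ℝ × (ℕ → ℝ)) => cellCount q.2.1 (q.1, q.2.2) := by
    refine measurable_from_prod_countable_right fun n => ?_
    simp only [cellCount, cellSum]
    refine Finset.measurable_fun_sum _ fun j _ => ?_
    have : (fun x : ℝ × (ℕ → ℝ) => (Iic x.1).indicator (fun _ => (1 : ℝ)) (x.2 j)) =
        {x : ℝ × (ℕ → ℝ) | x.2 j ≤ x.1}.indicator fun _ => 1 := by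
      ext x; simp [indicator_apply]
    rw [this]
    exact measurable_const.indicator (measurableSet_le (by fun_prop) (by fun_prop))
  exact h.comp (f := fun q : ℝ × (ℕ × (ℕ → ℝ)) => (q.2.1, (q.1, q.2.2))) (by fun_prop)

/-- Joint measurability in time and sample is needed to evaluate the process at an exponential time.
As the sum is taken in `ℝ≥0∞`, no summability enters; where it diverges the value is `0`. -/
lemma measurable_jumpProcess (a : ℕ → ℝ) :
    Measurable fun q : ℝ × JumpSpace => jumpProcess a q.1 q.2 := by
  refine Measurable.ennreal_toReal (Measurable.tsum fun i => ?_)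
  refine ENNReal.measurable_ofReal.comp (Measurable.const_mul ?_ _)
  exact measurable_cellCount.comp (f := fun q : ℝ × JumpSpace => (q.1, q.2 i)) (by fun_prop)

lemma jumpProcess_nonneg (a : ℕ → ℝ) (t : ℝ) (ω : JumpSpace) : 0 ≤ jumpProcess a t ω :=
  ENNReal.toReal_nonneg

section
variable {a : ℕ → ℝ}

/-- Cells starting at or after `N` have no points up to time `t ≤ N`. The bound does not depend on
`t`, so it also serves as a dominating function. -/
lemma IsRegularSample.jump_le (ha : ∀ k, 0 < a k) {ω : JumpSpace} (hω : IsRegularSample a ω)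
    {t : ℝ} {N : ℕ} (hN : t ≤ N) (i : ℕ × ℕ) :
    a i.2 * cellCount t (ω i) ≤ if i.1 < N then a i.2 * (ω i).1 else 0 := by
  split_ifs with h
  · exact mul_le_mul_of_nonneg_left (cellCount_le _ _) (ha _).le
  · rw [cellCount_eq_zero, mul_zero]
    intro j
    refine (hN.trans ?_).trans_lt (hω.1 i j).1
    exact_mod_cast not_lt.1 h

lemma IsRegularSample.summable (ha : ∀ k, 0 < a k) {ω : JumpSpace} (hω : IsRegularSample a ω)
    (t : ℝ) : Summable fun i : ℕ × ℕ => a i.2 * cellCount t (ω i) := by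
  obtain ⟨N, hN⟩ := exists_nat_ge t
  exact Summable.of_nonneg_of_le (fun i => mul_nonneg (ha _).le (cellCount_nonneg _ _))
    (hω.jump_le ha hN) (hω.2 N)

lemma IsRegularSample.hasSum (ha : ∀ k, 0 < a k) {ω : JumpSpace} (hω : IsRegularSample a ω)
    (t : ℝ) : HasSum (fun i : ℕ × ℕ => a i.2 * cellCount t (ω i)) (jumpProcess a t ω) := by
  have hn : ∀ i : ℕ × ℕ, 0 ≤ a i.2 * cellCount t (ω i) :=
    fun i => mul_nonneg (ha _).le (cellCount_nonneg _ _)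
  rw [jumpProcess, ← ENNReal.ofReal_tsum_of_nonneg hn (hω.summable ha t),
    ENNReal.toReal_ofReal (tsum_nonneg hn)]
  exact (hω.summable ha t).hasSum

lemma IsRegularSample.jumpProcess_zero (ha : ∀ k, 0 < a k) {ω : JumpSpace}
    (hω : IsRegularSample a ω) : jumpProcess a 0 ω = 0 := by
  refine (hω.hasSum ha 0).unique ?_
  convert hasSum_zero with i
  rw [cellCount_eq_zero, mul_zero]
  intro j
  refine lt_of_le_of_lt ?_ (hω.1 i j).1
  positivity

lemma IsRegularSample.monotone (ha : ∀ k, 0 < a k) {ω : JumpSpace}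
    (hω : IsRegularSample a ω) : Monotone fun t => jumpProcess a t ω := fun s t h =>
  hasSum_le (fun _ => mul_le_mul_of_nonneg_left (cellCount_mono h _) (ha _).le)
    (hω.hasSum ha s) (hω.hasSum ha t)

lemma continuousWithinAt_cellCount (p : ℕ × (ℕ → ℝ)) (t : ℝ) :
    ContinuousWithinAt (fun s => cellCount s p) (Ici t) t := by
  unfold cellCount cellSum ContinuousWithinAt
  refine tendsto_finsetSum _ fun j _ => ?_
  by_cases h : p.2 j ≤ t
  · refine (tendsto_const_nhds (x := (1 : ℝ))).congr' ?_ |>.trans_eq ?_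
    · filter_upwards [self_mem_nhdsWithin] with s hs
      rw [indicator_of_mem (by exact h.trans hs)]
    · rw [indicator_of_mem (by exact h)]
  · push Not at h
    refine (tendsto_const_nhds (x := (0 : ℝ))).congr' ?_ |>.trans_eq ?_
    · filter_upwards [nhdsWithin_le_nhds (Iio_mem_nhds h)] with s hs
      rw [indicator_of_notMem (by simpa using hs)]
    · rw [indicator_of_notMem (by simpa using h)]

lemma IsRegularSample.continuousWithinAt (ha : ∀ k, 0 < a k) {ω : JumpSpace}
    (hω : IsRegularSample a ω) (t : ℝ) :
    ContinuousWithinAt (fun s => jumpProcess a s ω) (Ici t) t := by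
  -- Strict inequality, so that `N` still dominates all times near `t`.
  obtain ⟨N, hN⟩ := exists_nat_gt t
  have h : ∀ s, jumpProcess a s ω = ∑' i : ℕ × ℕ, a i.2 * cellCount s (ω i) := fun s =>
    (hω.hasSum ha s).tsum_eq.symm
  rw [ContinuousWithinAt, h t]
  simp_rw [h]
  refine tendsto_tsum_of_dominated_convergence (hω.2 N)
    (fun i => (continuousWithinAt_cellCount (ω i) t).const_mul (a i.2)) ?_
  filter_upwards [nhdsWithin_le_nhds (Iio_mem_nhds hN)] with s hs i
  rw [Real.norm_of_nonneg (mul_nonneg (ha _).le (cellCount_nonneg _ _))]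
  exact hω.jump_le ha (le_of_lt hs) i

end

lemma lintegral_natCast_poissonMeasure (r : ℝ≥0) : ∫⁻ n, (n : ℝ≥0∞) ∂(poissonMeasure r) = r := by
  have h1 : ∑' n : ℕ, ENNReal.ofReal (Real.exp (-r) * r ^ n / n.factorial) = 1 := by
    rw [← ENNReal.ofReal_tsum_of_nonneg (fun n => by positivity)
      (hasSum_one_poissonMeasure r).summable, (hasSum_one_poissonMeasure r).tsum_eq,
      ENNReal.ofReal_one]
  rw [poissonMeasure, lintegral_sum_measure]
  simp only [lintegral_smul_measure, lintegral_dirac, smul_eq_mul]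
  rw [tsum_eq_zero_add' ENNReal.summable]
  simp only [Nat.cast_zero, mul_zero, zero_add]
  calc ∑' n : ℕ, ENNReal.ofReal (Real.exp (-r) * r ^ (n + 1) / (n + 1).factorial) *
        ((n + 1 : ℕ) : ℝ≥0∞)
      = ∑' n : ℕ, r * ENNReal.ofReal (Real.exp (-r) * r ^ n / n.factorial) := by
        congr with n
        rw [← ENNReal.ofReal_natCast, ← ENNReal.ofReal_coe_nnreal,
          ← ENNReal.ofReal_mul (by positivity), ← ENNReal.ofReal_mul (by positivity)]
        congr 1
        rw [Nat.factorial_succ, pow_succ]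
        push_cast
        field_simp
    _ = r := by rw [ENNReal.tsum_mul_left, h1, mul_one]

lemma lintegral_cell_number (lam : ℕ → ℝ≥0) (i : ℕ × ℕ) :
    ∫⁻ ω, ((ω i).1 : ℝ≥0∞) ∂(jumpLaw lam) = lam i.2 := by
  rw [← lintegral_natCast_poissonMeasure (lam i.2)]
  have h := (measurePreserving_fst (μ := poissonMeasure (lam i.2))
    (ν := Measure.infinitePi fun _ : ℕ => volume.restrict (Ioc (i.1 : ℝ) (i.1 + 1)))).comp
    (measurePreserving_eval_infinitePi (fun i : ℕ × ℕ => cellLaw (lam i.2) i.1) i)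
  exact h.lintegral_comp (f := fun n : ℕ => (n : ℝ≥0∞)) (by fun_prop)

/-- The expected sum of the jumps in the first `N` unit cells is `N ∑ lam k * a k`, which is finite.
-/
lemma ae_isRegularSample {a : ℕ → ℝ} {lam : ℕ → ℝ≥0} (ha : ∀ k, 0 < a k)
    (hs : Summable fun k => (lam k : ℝ) * a k) :
    ∀ᵐ ω ∂jumpLaw lam, IsRegularSample a ω := by
  refine Filter.Eventually.and ?_ ?_
  · rw [ae_all_iff]; intro i
    rw [ae_all_iff]; intro j
    have h := (measurePreserving_eval_infinitePi
        (fun _ : ℕ => (volume : Measure ℝ).restrict (Ioc (i.1 : ℝ) (i.1 + 1))) j).comp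
      ((measurePreserving_snd (μ := poissonMeasure (lam i.2))
        (ν := Measure.infinitePi fun _ : ℕ => volume.restrict (Ioc (i.1 : ℝ) (i.1 + 1)))).comp
        (measurePreserving_eval_infinitePi (fun i : ℕ × ℕ => cellLaw (lam i.2) i.1) i))
    exact h.quasiMeasurePreserving.ae (ae_restrict_mem measurableSet_Ioc)
  · rw [ae_all_iff]; intro N
    set b : JumpSpace → ℕ × ℕ → ℝ≥0∞ := fun ω i =>
      if i.1 < N then ENNReal.ofReal (a i.2) * ((ω i).1 : ℝ≥0∞) else 0 with hb
    have hbm : ∀ i, Measurable fun ω => b ω i := fun i => by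
      simp only [hb]
      split_ifs <;> fun_prop
    have hint : ∫⁻ ω, ∑' i, b ω i ∂(jumpLaw lam) ≠ ∞ := by
      rw [lintegral_tsum fun i => (hbm i).aemeasurable]
      have : ∀ i : ℕ × ℕ, ∫⁻ ω, b ω i ∂(jumpLaw lam) =
          if i.1 < N then ENNReal.ofReal (lam i.2 * a i.2) else 0 := by
        intro i
        simp only [hb]
        split_ifs
        · rw [lintegral_const_mul _ (by fun_prop), lintegral_cell_number,
            ENNReal.ofReal_mul (by positivity), ENNReal.ofReal_coe_nnreal, mul_comm]
        · simp
      simp_rw [this]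
      rw [ENNReal.tsum_prod', tsum_eq_sum (s := Finset.range N)]
      · refine (ENNReal.sum_lt_top.2 fun n hn => ?_).ne
        simp only [Finset.mem_range.1 hn, if_true]
        rw [← ENNReal.ofReal_tsum_of_nonneg (fun k => mul_nonneg (by positivity) (ha k).le) hs]
        exact ENNReal.ofReal_lt_top
      · intro n hn
        simp [Finset.mem_range.not.1 hn]
    filter_upwards [ae_lt_top (Measurable.tsum hbm) hint] with ω hω
    convert ENNReal.summable_toReal hω.ne with i
    simp only [hb]
    split_ifs <;> simp [(ha _).le]

/-! ### Exponential moments and the subordinator property -/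

/-- The exponent `∑ lam k (e ^ (z a k) - 1)` of the pure jump process on the left half plane. -/
def jumpExponent (a : ℕ → ℝ) (lam : ℕ → ℝ≥0) (z : ℂ) : ℂ :=
  ∑' k, (lam k : ℂ) * (Complex.exp (a k * z) - 1)

lemma norm_exp_sub_one_le_of_re_nonpos {z : ℂ} (hz : z.re ≤ 0) :
    ‖Complex.exp z - 1‖ ≤ 2 * ‖z‖ := by
  rcases le_or_gt ‖z‖ 1 with h | h
  · exact Complex.norm_exp_sub_one_le h
  · have h1 : ‖Complex.exp z‖ ≤ 1 := by
      rw [Complex.norm_exp]; exact Real.exp_le_one_iff.2 hz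
    calc ‖Complex.exp z - 1‖ ≤ ‖Complex.exp z‖ + ‖(1 : ℂ)‖ := norm_sub_le _ _
      _ ≤ 2 * ‖z‖ := by rw [norm_one]; linarith

section
variable {a : ℕ → ℝ} {lam : ℕ → ℝ≥0}

lemma summable_norm_jumpExponent (ha : ∀ k, 0 < a k) (hs : Summable fun k => (lam k : ℝ) * a k)
    {z : ℂ} (hz : z.re ≤ 0) :
    Summable fun k => ‖(lam k : ℂ) * (Complex.exp (a k * z) - 1)‖ := by
  refine Summable.of_nonneg_of_le (fun _ => norm_nonneg _) (fun k => ?_) (hs.mul_left (2 * ‖z‖))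
  have h : ‖Complex.exp (a k * z) - 1‖ ≤ 2 * ‖(a k : ℂ) * z‖ :=
    norm_exp_sub_one_le_of_re_nonpos (by
      rw [Complex.re_ofReal_mul]
      exact mul_nonpos_of_nonneg_of_nonpos (ha k).le hz)
  rw [norm_mul, Complex.norm_real, Real.norm_of_nonneg (ha k).le] at h
  have hl : ‖(lam k : ℂ)‖ = lam k := by simp
  rw [norm_mul, hl]
  calc (lam k : ℝ) * ‖Complex.exp (a k * z) - 1‖ ≤ lam k * (2 * (a k * ‖z‖)) := by gcongr
    _ = _ := by ring

/-- The unit cells tile `(0, ∞)`, so the pieces they cut from `(s, t]` have total length `t - s`. -/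
lemma hasSum_volume_Ioc_inter {s t : ℝ} (h0 : 0 ≤ s) (hst : s ≤ t) :
    HasSum (fun n : ℕ => ∫ u in Ioc (n : ℝ) (n + 1), (Ioc s t).indicator (fun _ => (1 : ℝ)) u)
      (t - s) := by
  have hU : ⋃ n : ℕ, Ioc (n : ℝ) (n + 1) = Ioi 0 := by
    ext x
    simp only [mem_iUnion, mem_Ioc, mem_Ioi]
    constructor
    · rintro ⟨n, hn, -⟩
      exact lt_of_le_of_lt (by positivity) hn
    · intro hx
      have h1 : 0 < ⌈x⌉₊ := Nat.ceil_pos.2 hx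
      refine ⟨⌈x⌉₊ - 1, ?_, ?_⟩
      · exact Nat.lt_ceil.1 (by lia)
      · calc x ≤ (⌈x⌉₊ : ℝ) := Nat.le_ceil x
          _ = _ := by push_cast [h1]; ring
  have hd : Pairwise (Function.onFun Disjoint fun n : ℕ => Ioc (n : ℝ) (n + 1)) := by
    have := (Nat.mono_cast (α := ℝ)).pairwise_disjoint_on_Ioc_succ
    simpa using this
  have hi : Integrable ((Ioc s t).indicator fun _ => (1 : ℝ)) :=
    (integrable_indicator_iff measurableSet_Ioc).2 (by simp)
  have h := hasSum_integral_iUnion (μ := volume) (fun n => measurableSet_Ioc) hd hi.integrableOn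
  rw [hU, setIntegral_indicator measurableSet_Ioc,
    inter_eq_right.2 fun x (hx : x ∈ Ioc s t) => mem_Ioi.2 (lt_of_le_of_lt h0 hx.1)] at h
  simpa [hst] using h

/-- At most one indicator is nonzero at `u`. This is the source of independence: in Campbell's
exponent, disjoint time intervals contribute additively. -/
lemma exp_sum_indicator_sub_one {ι : Type*} [Fintype ι] {I : ι → Set ℝ}
    (hI : Pairwise (Function.onFun Disjoint I)) (w : ι → ℂ) (u : ℝ) :
    Complex.exp (∑ l, w l * ((I l).indicator (fun _ => (1 : ℝ)) u : ℝ)) - 1 =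
      ∑ l, (Complex.exp (w l) - 1) * ((I l).indicator (fun _ => (1 : ℝ)) u : ℝ) := by
  classical
  by_cases h : ∃ l, u ∈ I l
  · obtain ⟨l, hl⟩ := h
    have hn : ∀ l', l' ≠ l → (I l').indicator (fun _ => (1 : ℝ)) u = 0 := fun l' h' =>
      indicator_of_notMem (fun h'' => (hI h').le_bot ⟨h'', hl⟩) _
    rw [Finset.sum_eq_single l (fun l' _ h' => by simp [hn l' h']) (by simp),
      Finset.sum_eq_single l (fun l' _ h' => by simp [hn l' h']) (by simp)]
    simp [hl]
  · push Not at h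
    simp [h]

lemma hasSum_mul_of_summable_norm {v w : ℕ → ℂ} {x y : ℂ} (hv : HasSum v x) (hw : HasSum w y)
    (hvn : Summable fun n => ‖v n‖) (hwn : Summable fun n => ‖w n‖) :
    HasSum (fun i : ℕ × ℕ => v i.1 * w i.2) (x * y) :=
  hv.mul hw (summable_mul_of_summable_norm hvn hwn)

/-- The joint exponential moments of increments of the jump process over disjoint intervals. -/
lemma integral_exp_jumpProcess_increments (ha : ∀ k, 0 < a k)
    (hs : Summable fun k => (lam k : ℝ) * a k) {ι : Type*} [Fintype ι] {s t : ι → ℝ}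
    (hs0 : ∀ l, 0 ≤ s l) (hst : ∀ l, s l ≤ t l)
    (hd : Pairwise (Function.onFun Disjoint fun l => Ioc (s l) (t l)))
    {z : ι → ℂ} (hz : ∀ l, (z l).re ≤ 0) :
    ∫ ω, Complex.exp (∑ l, z l * ((jumpProcess a (t l) ω - jumpProcess a (s l) ω : ℝ) : ℂ))
        ∂(jumpLaw lam) =
      Complex.exp (∑ l, ((t l - s l : ℝ) : ℂ) * jumpExponent a lam (z l)) := by
  -- Weight of a point at time `u` in cell `(n, k)`: a jump `a k`, multiplied by the `z l` of the
  -- interval that contains `u`.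
  set g : ℕ × ℕ → ℝ → ℂ := fun i u =>
    ∑ l, (a i.2 * z l) * ((Ioc (s l) (t l)).indicator (fun _ => (1 : ℝ)) u : ℝ) with hg
  refine integral_exp_of_hasSum_cellSum (g := g) (fun i => ?_) (fun i u => ?_) ?_ ?_
  · refine Finset.measurable_fun_sum _ fun l _ => Measurable.const_mul ?_ _
    exact Complex.measurable_ofReal.comp (measurable_const.indicator measurableSet_Ioc)
  · rw [hg, Complex.re_sum]
    refine Finset.sum_nonpos fun l _ => ?_
    rw [Complex.re_mul_ofReal, Complex.re_ofReal_mul]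
    exact mul_nonpos_of_nonpos_of_nonneg (mul_nonpos_of_nonneg_of_nonpos (ha _).le (hz l))
      (indicator_nonneg (fun _ _ => zero_le_one) _)
  · filter_upwards [ae_isRegularSample ha hs] with ω hω
    have h1 : ∀ i, cellSum (g i) (ω i) = ∑ l, z l *
        ((a i.2 * cellCount (t l) (ω i) - a i.2 * cellCount (s l) (ω i) : ℝ) : ℂ) := by
      intro i
      simp_rw [← mul_sub, cellCount_sub_cellCount (hst _)]
      rw [cellSum, Finset.sum_comm]
      refine Finset.sum_congr rfl fun l _ => ?_
      rw [cellSum]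
      push_cast
      rw [Finset.mul_sum, Finset.mul_sum]
      refine Finset.sum_congr rfl fun j _ => ?_
      ring
    simp_rw [h1]
    refine hasSum_sum fun l _ => HasSum.mul_left _ ?_
    exact_mod_cast (hω.hasSum ha (t l)).sub (hω.hasSum ha (s l))
  · have h2 : ∀ i : ℕ × ℕ, (lam i.2 : ℂ) *
        ∫ u in Ioc (i.1 : ℝ) (i.1 + 1), (Complex.exp (g i u) - 1) =
        ∑ l, ((∫ u in Ioc (i.1 : ℝ) (i.1 + 1),
          (Ioc (s l) (t l)).indicator (fun _ => (1 : ℝ)) u : ℝ) : ℂ) *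
            ((lam i.2 : ℂ) * (Complex.exp (a i.2 * z l) - 1)) := by
      intro i
      simp only [hg]
      simp_rw [exp_sum_indicator_sub_one hd]
      rw [integral_finsetSum, Finset.mul_sum]
      · refine Finset.sum_congr rfl fun l _ => ?_
        rw [integral_const_mul, integral_complex_ofReal]
        ring
      · intro l _
        refine Integrable.const_mul (Integrable.ofReal ?_) _
        exact (integrable_const _).indicator measurableSet_Ioc
    simp_rw [h2]
    refine hasSum_sum fun l _ => ?_
    have hw := hasSum_volume_Ioc_inter (hs0 l) (hst l)
    have he := summable_norm_jumpExponent ha hs (hz l)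
    have hw' : HasSum (fun n : ℕ => ((∫ u in Ioc (n : ℝ) (n + 1),
        (Ioc (s l) (t l)).indicator (fun _ => (1 : ℝ)) u : ℝ) : ℂ)) ((t l - s l : ℝ) : ℂ) := by
      exact_mod_cast hw
    have he' : HasSum (fun k => (lam k : ℂ) * (Complex.exp (a k * z l) - 1))
      (jumpExponent a lam (z l)) := he.of_norm.hasSum
    have hwn : Summable fun n : ℕ => ‖((∫ u in Ioc (n : ℝ) (n + 1),
        (Ioc (s l) (t l)).indicator (fun _ => (1 : ℝ)) u : ℝ) : ℂ)‖ := by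
      simp_rw [Complex.norm_real]
      exact hw.summable.norm
    -- The double series over cells is a product: time lengths summed over `n`, jump sizes summed
    -- over `k`.
    convert hasSum_mul_of_summable_norm hw' he' hwn he using 1

lemma integral_exp_jumpProcess_increment (ha : ∀ k, 0 < a k)
    (hs : Summable fun k => (lam k : ℝ) * a k) {s t : ℝ} (hs0 : 0 ≤ s) (hst : s ≤ t)
    {z : ℂ} (hz : z.re ≤ 0) :
    ∫ ω, Complex.exp (z * ((jumpProcess a t ω - jumpProcess a s ω : ℝ) : ℂ)) ∂(jumpLaw lam) =
      Complex.exp (((t - s : ℝ) : ℂ) * jumpExponent a lam z) := by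
  have := integral_exp_jumpProcess_increments (lam := lam) ha hs (ι := Unit) (s := fun _ => s)
    (t := fun _ => t) (fun _ => hs0) (fun _ => hst) (fun i j h => (h rfl).elim)
    (z := fun _ => z) fun _ => hz
  simpa using this

lemma measurable_jumpProcess_right (a : ℕ → ℝ) (t : ℝ) : Measurable (jumpProcess a t) :=
  (measurable_jumpProcess a).comp (f := fun ω : JumpSpace => (t, ω)) (by fun_prop)

lemma charFun_jumpProcess_increment (ha : ∀ k, 0 < a k)
    (hs : Summable fun k => (lam k : ℝ) * a k) {s t : ℝ} (hs0 : 0 ≤ s) (hst : s ≤ t) (θ : ℝ) :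
    charFun ((jumpLaw lam).map fun ω => jumpProcess a t ω - jumpProcess a s ω) θ =
      Complex.exp (((t - s : ℝ) : ℂ) * jumpExponent a lam (θ * Complex.I)) := by
  have hm : Measurable fun ω => jumpProcess a t ω - jumpProcess a s ω :=
    (measurable_jumpProcess_right a t).sub (measurable_jumpProcess_right a s)
  rw [← integral_exp_jumpProcess_increment ha hs hs0 hst (by simp), charFun_apply_real,
    integral_map hm.aemeasurable (by fun_prop)]
  congr with ω
  ring_nf

/-- The path properties hold on regular samples. The joint characteristic function of the increments
factors, and that of a single increment depends only on its duration. -/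
lemma isSubordinator_jumpProcess (ha : ∀ k, 0 < a k)
    (hs : Summable fun k => (lam k : ℝ) * a k) :
    IsSubordinator (jumpLaw lam) fun t : ℝ≥0 => jumpProcess a t where
  measurable t := measurable_jumpProcess_right a t
  zero := (ae_isRegularSample ha hs).mono fun ω hω => hω.jumpProcess_zero ha
  mono := (ae_isRegularSample ha hs).mono fun ω hω =>
    (hω.monotone ha).comp NNReal.coe_mono
  rightCts := (ae_isRegularSample ha hs).mono fun ω hω t =>
    (hω.continuousWithinAt ha t).comp (f := ((↑) : ℝ≥0 → ℝ)) (t := Ici (t : ℝ))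
      NNReal.continuous_coe.continuousWithinAt fun s hs => NNReal.coe_le_coe.2 hs
  indep n t ht := by
    have hm : ∀ i : Fin n, Measurable fun ω =>
        jumpProcess a (t i.succ) ω - jumpProcess a (t i.castSucc) ω := fun i =>
      (measurable_jumpProcess_right a _).sub (measurable_jumpProcess_right a _)
    rw [iIndepFun_iff_charFun_pi fun i => (hm i).aemeasurable]
    intro θ
    have hle : ∀ i : Fin n, (t i.castSucc : ℝ) ≤ t i.succ := fun i =>
      NNReal.coe_le_coe.2 (ht (Fin.castSucc_le_succ i))
    simp_rw [charFun_jumpProcess_increment ha hs (NNReal.coe_nonneg _) (hle _)]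
    rw [← Complex.exp_sum, ← integral_exp_jumpProcess_increments ha hs
      (fun i : Fin n => NNReal.coe_nonneg _) hle ?_ (by simp), charFun_apply, integral_map]
    · congr with ω
      rw [PiLp.inner_apply]
      push_cast
      rw [Finset.sum_mul]
      congr 1
      refine Finset.sum_congr rfl fun i _ => ?_
      simp
      ring
    · exact (WithLp.measurable_toLp 2 _).comp_aemeasurable
        (measurable_pi_lambda _ hm).aemeasurable
    · fun_prop
    · refine (symm_disjoint.pairwise_on _).2 fun i j hij => ?_
      refine Ioc_disjoint_Ioc_of_le ?_
      exact NNReal.coe_le_coe.2 (ht (by simpa [Fin.le_def] using hij))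
  stationary s t := by
    have hm := fun t => measurable_jumpProcess_right a t
    refine ⟨((hm _).sub (hm _)).aemeasurable, (hm _).aemeasurable, ?_⟩
    have : IsProbabilityMeasure ((jumpLaw lam).map (jumpProcess a (t : ℝ))) :=
      Measure.isProbabilityMeasure_map (hm _).aemeasurable
    have : IsProbabilityMeasure ((jumpLaw lam).map fun ω =>
        jumpProcess a ((s + t : ℝ≥0) : ℝ) ω - jumpProcess a (s : ℝ) ω) :=
      Measure.isProbabilityMeasure_map ((hm _).sub (hm _)).aemeasurable
    have h0 : (jumpLaw lam).map (jumpProcess a (t : ℝ)) =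
        (jumpLaw lam).map fun ω => jumpProcess a (t : ℝ) ω - jumpProcess a 0 ω :=
      Measure.map_congr ((ae_isRegularSample ha hs).mono fun ω hω => by
        simp [hω.jumpProcess_zero ha])
    refine Measure.ext_of_charFun (funext fun θ => ?_)
    rw [h0, charFun_jumpProcess_increment ha hs (NNReal.coe_nonneg _) (by simp),
      charFun_jumpProcess_increment ha hs le_rfl (by simp)]
    simp

lemma jumpExponent_neg_ofReal (q : ℝ) :
    jumpExponent a lam (-q : ℝ) = ((-laplaceExponent a lam q : ℝ) : ℂ) := by
  rw [jumpExponent, laplaceExponent, ← tsum_neg, Complex.ofReal_tsum]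
  congr with k
  push_cast
  ring_nf

lemma integral_exp_neg_jumpProcess (ha : ∀ k, 0 < a k)
    (hs : Summable fun k => (lam k : ℝ) * a k) {t q : ℝ} (ht : 0 ≤ t) (hq : 0 ≤ q) :
    ∫ ω, Real.exp (-(q * jumpProcess a t ω)) ∂(jumpLaw lam) =
      Real.exp (-(t * laplaceExponent a lam q)) := by
  have h := integral_exp_jumpProcess_increment (lam := lam) ha hs le_rfl ht
    (z := (-q : ℝ)) (by simpa using hq)
  rw [jumpExponent_neg_ofReal] at h
  have h2 : ∫ ω, Complex.exp (((-q : ℝ) : ℂ) * ((jumpProcess a t ω - jumpProcess a 0 ω : ℝ) : ℂ))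
      ∂(jumpLaw lam) = ∫ ω, ((Real.exp (-(q * jumpProcess a t ω)) : ℝ) : ℂ) ∂(jumpLaw lam) := by
    refine integral_congr_ae ((ae_isRegularSample ha hs).mono fun ω hω => ?_)
    simp [hω.jumpProcess_zero ha]
  rw [h2, integral_complex_ofReal] at h
  rw [← Complex.ofReal_inj, h]
  push_cast
  ring_nf

/-! ### The potential measure -/

/-- The law of the jump process at an independent exponential time. -/
def jumpPotential (a : ℕ → ℝ) (lam : ℕ → ℝ≥0) : Measure ℝ :=
  ((((volume : Measure ℝ).restrict (Ioi 0)).withDensity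
    fun t => ENNReal.ofReal (Real.exp (-t))).prod (jumpLaw lam)).map
      fun p => jumpProcess a p.1.toNNReal p.2

lemma measurable_jumpProcess_toNNReal (a : ℕ → ℝ) :
    Measurable fun p : ℝ × JumpSpace => jumpProcess a p.1.toNNReal p.2 :=
  (measurable_jumpProcess a).comp
    (f := fun p : ℝ × JumpSpace => ((p.1.toNNReal : ℝ), p.2)) (by fun_prop)

instance isProbabilityMeasure_withDensity_exp_neg : IsProbabilityMeasure
    (((volume : Measure ℝ).restrict (Ioi 0)).withDensity
      fun t => ENNReal.ofReal (Real.exp (-t))) := by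
  constructor
  rw [withDensity_apply _ MeasurableSet.univ, Measure.restrict_univ,
    ← ofReal_integral_eq_lintegral_ofReal (integrableOn_exp_neg_Ioi 0)
      (.of_forall fun t => (Real.exp_pos _).le), integral_exp_neg_Ioi_zero, ENNReal.ofReal_one]

instance (a : ℕ → ℝ) (lam : ℕ → ℝ≥0) : IsProbabilityMeasure (jumpPotential a lam) :=
  Measure.isProbabilityMeasure_map (measurable_jumpProcess_toNNReal a).aemeasurable

lemma isOnePotentialMeasure_jumpPotential :
    IsOnePotentialMeasure (jumpLaw lam) (fun t : ℝ≥0 => jumpProcess a t)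
      (jumpPotential a lam) := by
  intro A hA
  have hm := measurable_jumpProcess_toNNReal a
  rw [jumpPotential, Measure.map_apply hm hA, Measure.prod_apply (hm hA),
    lintegral_withDensity_eq_lintegral_mul _ (by fun_prop) (measurable_measure_prodMk_left (hm hA))]
  refine lintegral_congr fun t => ?_
  rw [Pi.mul_apply, mul_comm]
  rfl

/-- This is `∫ e⁻ᵗ e^(-t Φ(q)) dt` over `t > 0`. -/
lemma integral_exp_neg_jumpPotential (ha : ∀ k, 0 < a k)
    (hs : Summable fun k => (lam k : ℝ) * a k) {q : ℝ} (hq : 0 ≤ q) :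
    ∫ s, Real.exp (-(q * s)) ∂(jumpPotential a lam) = (1 + laplaceExponent a lam q)⁻¹ := by
  have hm := measurable_jumpProcess_toNNReal a
  have hΦ := laplaceExponent_nonneg (lam := lam) ha hq
  rw [jumpPotential, integral_map hm.aemeasurable (by fun_prop), integral_prod]
  · rw [integral_withDensity_eq_integral_toReal_smul (by fun_prop) (by simp)]
    have : ∀ t ∈ Ioi (0 : ℝ), (ENNReal.ofReal (Real.exp (-t))).toReal •
        ∫ ω, Real.exp (-(q * jumpProcess a t.toNNReal ω)) ∂(jumpLaw lam) =
        Real.exp (-(1 + laplaceExponent a lam q) * t) := by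
      intro t ht
      have ht : 0 ≤ t := le_of_lt ht
      rw [ENNReal.toReal_ofReal (by positivity), Real.coe_toNNReal _ ht,
        integral_exp_neg_jumpProcess ha hs ht hq, smul_eq_mul, ← Real.exp_add]
      ring_nf
    rw [setIntegral_congr_fun measurableSet_Ioi this,
      integral_exp_mul_Ioi (by linarith)]
    rw [mul_zero, Real.exp_zero, neg_div_neg_eq, one_div]
  · refine Integrable.of_bound (hm.const_mul q).neg.exp.aestronglyMeasurable 1 (.of_forall fun p => ?_)
    rw [Real.norm_of_nonneg (by positivity), Real.exp_le_one_iff, neg_nonpos]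
    exact mul_nonneg hq (jumpProcess_nonneg _ _ _)

end

/-- The measure lives on `[0, ∞)`, and an atom at `0` would bound its Laplace transform `1 / (1 +
Φ)` from below, whereas `Φ → ∞`. -/
lemma jumpPotential_Iic_zero (α : ℝ) (hα : 0 < α) :
    jumpPotential jumpSize (jumpRate α) (Iic 0) = 0 := by
  set U := jumpPotential jumpSize (jumpRate α) with hU
  have hneg : ∀ᵐ s ∂U, 0 ≤ s := by
    rw [hU, jumpPotential, ae_map_iff (measurable_jumpProcess_toNNReal _).aemeasurable
      measurableSet_Ici]
    exact .of_forall fun p => jumpProcess_nonneg _ _ _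
  have hle : ∀ q, 0 ≤ q →
      U.real (Iic 0) ≤ (1 + laplaceExponent jumpSize (jumpRate α) q)⁻¹ := by
    intro q hq
    rw [← integral_exp_neg_jumpPotential jumpSize_pos (summable_jumpRate_mul_jumpSize α) hq,
      ← integral_indicator_one measurableSet_Iic]
    refine integral_mono_of_nonneg (.of_forall fun s => indicator_nonneg (by simp) _) ?_ ?_
    · refine Integrable.of_bound (by fun_prop) 1 (hneg.mono fun s hs => ?_)
      rw [Real.norm_of_nonneg (by positivity), Real.exp_le_one_iff, neg_nonpos]
      positivity
    · filter_upwards [hneg] with s hs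
      by_cases h : s ∈ Iic (0 : ℝ)
      · have : s = 0 := le_antisymm h hs
        simp [this]
      · rw [indicator_of_notMem h]; positivity
  have h0 : U.real (Iic 0) ≤ 0 := by
    refine ge_of_tendsto (tendsto_inv_atTop_zero.comp
      (Filter.tendsto_atTop_add_const_left _ 1 (tendsto_laplaceExponent_atTop α hα))) ?_
    filter_upwards [Filter.eventually_ge_atTop 0] with q hq
    exact hle q hq
  exact (measureReal_eq_zero_iff).1 (le_antisymm h0 measureReal_nonneg)

/-! ### Comparing the heat kernel with exponentials in time -/

/-- The radial profile of the heat kernel of `ℝ³`. -/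
def radialHeatKernel (s r : ℝ) : ℝ :=
  (2 * Real.pi * s) ^ (-(3 / 2) : ℝ) * Real.exp (-r ^ 2 / (2 * s))

/-- The radial profile of the mixture of heat kernels with mixing measure `μ`. -/
def radialPotential (μ : Measure ℝ) (r : ℝ) : ℝ := ∫ s, radialHeatKernel s r ∂μ

/-- The Laplace transform of `μ`. -/
def laplaceIntegral (μ : Measure ℝ) (q : ℝ) : ℝ := ∫ s, Real.exp (-(q * s)) ∂μ

lemma radialHeatKernel_pos {s : ℝ} (hs : 0 < s) (r : ℝ) : 0 < radialHeatKernel s r := by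
  unfold radialHeatKernel; positivity

lemma measurable_radialHeatKernel : Measurable fun p : ℝ × ℝ => radialHeatKernel p.1 p.2 := by
  unfold radialHeatKernel; fun_prop

lemma continuous_radialHeatKernel (s : ℝ) : Continuous (radialHeatKernel s) := by
  unfold radialHeatKernel; fun_prop

lemma radialHeatKernel_antitone {s r r' : ℝ} (hs : 0 < s) (hr : 0 ≤ r) (h : r ≤ r') :
    radialHeatKernel s r' ≤ radialHeatKernel s r := by
  unfold radialHeatKernel; gcongr

lemma radialHeatKernel_le {s : ℝ} (hs : 0 < s) (r : ℝ) :
    radialHeatKernel s r ≤ 3 ^ (3 / 2 : ℝ) * (s + r ^ 2) ^ (-(3 / 2) : ℝ) := by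
  set q := r ^ 2 / (2 * s) with hq
  have hq0 : 0 ≤ q := by positivity
  have h1 : s + r ^ 2 = s * (1 + 2 * q) := by rw [hq]; field_simp
  -- The exponent `2 q / 3` becomes exactly `-q` after raising to the power `-3/2`.
  have h2 : 1 + 2 * q ≤ 3 * Real.exp (2 * q / 3) := by
    have := Real.add_one_le_exp (2 * q / 3); linarith
  have h3 : (3 * Real.exp (2 * q / 3)) ^ (-(3 / 2) : ℝ) ≤ (1 + 2 * q) ^ (-(3 / 2) : ℝ) :=
    Real.rpow_le_rpow_of_nonpos (by positivity) h2 (by norm_num)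
  have h4 : (3 * Real.exp (2 * q / 3)) ^ (-(3 / 2) : ℝ) =
      3 ^ (-(3 / 2) : ℝ) * Real.exp (-q) := by
    rw [Real.mul_rpow (by norm_num) (by positivity), ← Real.exp_mul]
    ring_nf
  have h5 : (2 * Real.pi * s) ^ (-(3 / 2) : ℝ) ≤ s ^ (-(3 / 2) : ℝ) := by
    refine Real.rpow_le_rpow_of_nonpos hs ?_ (by norm_num)
    have := Real.pi_gt_three
    nlinarith
  have h6 : (3 : ℝ) ^ (3 / 2 : ℝ) * 3 ^ (-(3 / 2) : ℝ) = 1 := by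
    rw [← Real.rpow_add (by norm_num)]; norm_num
  calc radialHeatKernel s r ≤ s ^ (-(3 / 2) : ℝ) * Real.exp (-q) := by
        unfold radialHeatKernel
        rw [hq, neg_div]
        gcongr
    _ = s ^ (-(3 / 2) : ℝ) * (3 ^ (3 / 2 : ℝ) * (3 ^ (-(3 / 2) : ℝ) * Real.exp (-q))) := by
        rw [← mul_assoc (3 ^ (3 / 2 : ℝ)), h6, one_mul]
    _ ≤ s ^ (-(3 / 2) : ℝ) * (3 ^ (3 / 2 : ℝ) * (1 + 2 * q) ^ (-(3 / 2) : ℝ)) := by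
        rw [← h4]; gcongr
    _ = _ := by rw [h1, Real.mul_rpow hs.le (by positivity)]; ring

lemma sq_rpow_neg_three_half {r : ℝ} (hr : 0 < r) : (r ^ 2) ^ (-(3 / 2) : ℝ) = (r ^ 3)⁻¹ := by
  rw [← Real.rpow_natCast, ← Real.rpow_mul hr.le, ← Real.rpow_natCast, ← Real.rpow_neg hr.le]
  norm_num

lemma radialHeatKernel_le_inv_cube {s r : ℝ} (hs : 0 < s) (hr : 0 < r) :
    radialHeatKernel s r ≤ 3 ^ (3 / 2 : ℝ) * (r ^ 3)⁻¹ := by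
  refine (radialHeatKernel_le hs r).trans ?_
  rw [← sq_rpow_neg_three_half hr]
  refine mul_le_mul_of_nonneg_left ?_ (by positivity)
  exact Real.rpow_le_rpow_of_nonpos (by positivity) (by linarith) (by norm_num)

/-- The left side is nonpositive for small `t`, where the Gaussian factor is tiny; for larger `t`
that factor is bounded below and `t^(-3/2)` dominates `e⁻ᵗ`. -/
lemma exists_mul_exp_sub_le (M : ℝ) (hM : 1 < M) : ∃ c : ℝ, 0 < c ∧ ∀ t : ℝ, 0 < t →
    c * (Real.exp (-t) - 2 * Real.exp (-(M * t))) ≤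
      (2 * Real.pi * t) ^ (-(3 / 2) : ℝ) * Real.exp (-1 / (2 * t)) := by
  -- The zero of `e⁻ᵗ - 2 e⁻ᴹᵗ`.
  set t₀ := Real.log 2 / (M - 1) with ht₀
  have hM1 : 0 < M - 1 := by linarith
  have ht₀0 : 0 < t₀ := div_pos (Real.log_pos (by norm_num)) hM1
  refine ⟨(3 * Real.pi) ^ (-(3 / 2) : ℝ) * Real.exp (-1 / (2 * t₀)), by positivity,
    fun t ht => ?_⟩
  rcases le_or_gt t t₀ with h | h
  · have h1 : Real.exp (-t) ≤ 2 * Real.exp (-(M * t)) := by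
      rw [ht₀, le_div_iff₀ hM1] at h
      calc Real.exp (-t) ≤ Real.exp (Real.log 2 + -(M * t)) := by
            rw [Real.exp_le_exp]; linarith
        _ = 2 * Real.exp (-(M * t)) := by rw [Real.exp_add, Real.exp_log (by norm_num)]
    refine le_trans (mul_nonpos_of_nonneg_of_nonpos (by positivity) (by linarith)) (by positivity)
  · have h1 : (3 * Real.pi) ^ (-(3 / 2) : ℝ) * Real.exp (-t) ≤ (2 * Real.pi * t) ^ (-(3 / 2) : ℝ) := by
      have h2 : 2 * Real.pi * t ≤ 3 * Real.pi * Real.exp (2 * t / 3) := by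
        have := Real.add_one_le_exp (2 * t / 3)
        have := Real.pi_pos
        nlinarith
      refine le_trans (le_of_eq ?_)
        (Real.rpow_le_rpow_of_nonpos (by positivity) h2 (by norm_num))
      rw [Real.mul_rpow (x := 3 * Real.pi) (by positivity) (by positivity), ← Real.exp_mul]
      ring_nf
    have h3 : Real.exp (-1 / (2 * t₀)) ≤ Real.exp (-1 / (2 * t)) := by
      rw [Real.exp_le_exp, neg_div, neg_div, neg_le_neg_iff]
      gcongr
    calc _ ≤ (3 * Real.pi) ^ (-(3 / 2) : ℝ) * Real.exp (-1 / (2 * t₀)) * Real.exp (-t) := by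
          gcongr
          have := Real.exp_pos (-(M * t))
          linarith
      _ = ((3 * Real.pi) ^ (-(3 / 2) : ℝ) * Real.exp (-t)) * Real.exp (-1 / (2 * t₀)) := by ring
      _ ≤ _ := by gcongr

lemma radialHeatKernel_scale {s r : ℝ} (hs : 0 < s) (hr : 0 < r) :
    radialHeatKernel s r = (r ^ 3)⁻¹ * ((2 * Real.pi * ((r ^ 2)⁻¹ * s)) ^ (-(3 / 2) : ℝ) *
      Real.exp (-1 / (2 * ((r ^ 2)⁻¹ * s)))) := by
  have h1 : 2 * Real.pi * s = r ^ 2 * (2 * Real.pi * ((r ^ 2)⁻¹ * s)) := by field_simp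
  have h2 : -r ^ 2 / (2 * s) = -1 / (2 * ((r ^ 2)⁻¹ * s)) := by field_simp
  rw [radialHeatKernel, h1, h2, Real.mul_rpow (by positivity) (by positivity),
    sq_rpow_neg_three_half hr, mul_assoc]

/-! ### Fourier transform of the heat kernel -/

lemma gaussian_exponent_eq (s : ℝ) (x z : E3) :
    Complex.exp (Complex.I * ((inner ℝ x z : ℝ) : ℂ)) * (heatKernel s x : ℂ) =
      (((2 * Real.pi * s) ^ (-(3 / 2) : ℝ) : ℝ) : ℂ) *
        Complex.exp (-((1 / (2 * s) : ℝ) : ℂ) * ‖x‖ ^ 2 + Complex.I * ((inner ℝ z x : ℝ) : ℂ)) := by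
  rw [heatKernel, real_inner_comm, Complex.exp_add]
  push_cast
  rw [show -(‖x‖ : ℂ) ^ 2 / (2 * s) = -(1 / (2 * s)) * ‖x‖ ^ 2 by ring]
  ring

lemma fourier_heatKernel {s : ℝ} (hs : 0 < s) (z : E3) :
    ∫ x : E3, Complex.exp (Complex.I * ((inner ℝ x z : ℝ) : ℂ)) * (heatKernel s x : ℂ) =
      (Real.exp (-(‖z‖ ^ 2 / 2 * s)) : ℂ) := by
  simp_rw [gaussian_exponent_eq s]
  rw [integral_const_mul, GaussianFourier.integral_cexp_neg_mul_sq_norm_add (by simpa using hs)]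
  have h1 : ((Real.pi : ℂ) / ((1 / (2 * s) : ℝ) : ℂ)) ^ ((Module.finrank ℝ E3 : ℂ) / 2) =
      (((2 * Real.pi * s) ^ (3 / 2 : ℝ) : ℝ) : ℂ) := by
    rw [Complex.ofReal_cpow (by positivity)]
    simp only [finrank_euclideanSpace, Fintype.card_fin]
    push_cast
    congr 1
    rw [one_div, div_inv_eq_mul]
    ring
  have h2 : (((2 * Real.pi * s) ^ (-(3 / 2) : ℝ) : ℝ) : ℂ) *
      (((2 * Real.pi * s) ^ (3 / 2 : ℝ) : ℝ) : ℂ) = 1 := by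
    rw [← Complex.ofReal_mul, ← Real.rpow_add (by positivity)]
    simp
  rw [h1, ← mul_assoc, h2, one_mul]
  push_cast
  rw [Complex.I_sq]
  congr 1
  have : (s : ℂ) ≠ 0 := by exact_mod_cast hs.ne'
  field_simp
  ring

lemma integral_heatKernel {s : ℝ} (hs : 0 < s) : ∫ x : E3, heatKernel s x = 1 := by
  have h := fourier_heatKernel hs 0
  simp only [inner_zero_right, Complex.ofReal_zero, mul_zero, Complex.exp_zero, one_mul,
    integral_complex_ofReal] at h
  have h' : ∫ x : E3, heatKernel s x = Real.exp (-(‖(0 : E3)‖ ^ 2 / 2 * s)) := by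
    exact_mod_cast h
  rw [h']
  simp

lemma integrable_heatKernel {s : ℝ} (hs : 0 < s) : Integrable (heatKernel s : E3 → ℝ) :=
  -- A nonintegrable function would have integral `0` by convention.
  Integrable.of_integral_ne_zero (by rw [integral_heatKernel hs]; exact one_ne_zero)

/-! ### Mixtures of heat kernels: regularity and two-sided bounds -/

lemma ae_pos_of_Iic_zero {μ : Measure ℝ} (hμ : μ (Iic 0) = 0) : ∀ᵐ s ∂μ, 0 < s := by
  rw [ae_iff]
  convert hμ using 2
  ext; simp

section
variable {μ : Measure ℝ} [IsProbabilityMeasure μ]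

lemma integral_pos_of_ae_pos {g : ℝ → ℝ} (hg : ∀ᵐ s ∂μ, 0 < g s) (hi : Integrable g μ) :
    0 < ∫ s, g s ∂μ := by
  have h0 : 0 ≤ᵐ[μ] g := hg.mono fun _ h => h.le
  refine lt_of_le_of_ne (integral_nonneg_of_ae h0) fun h => ?_
  have h1 := (integral_eq_zero_iff_of_nonneg_ae h0 hi).1 h.symm
  obtain ⟨s, hs1, hs2⟩ := (h1.and hg).exists
  exact hs2.ne' hs1

lemma integrable_radialHeatKernel (hμ : μ (Iic 0) = 0) {r : ℝ} (hr : 0 < r) :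
    Integrable (fun s => radialHeatKernel s r) μ := by
  refine Integrable.of_bound
    (measurable_radialHeatKernel.comp measurable_prodMk_right).aestronglyMeasurable
    (3 ^ (3 / 2 : ℝ) * (r ^ 3)⁻¹) ((ae_pos_of_Iic_zero hμ).mono fun s hs => ?_)
  rw [Real.norm_of_nonneg (radialHeatKernel_pos hs r).le]
  exact radialHeatKernel_le_inv_cube hs hr

lemma radialPotential_pos (hμ : μ (Iic 0) = 0) {r : ℝ} (hr : 0 < r) :
    0 < radialPotential μ r := by
  have hpos := ae_pos_of_Iic_zero hμ
  exact integral_pos_of_ae_pos (hpos.mono fun s hs => radialHeatKernel_pos hs r)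
    (integrable_radialHeatKernel hμ hr)

lemma radialPotential_antitoneOn (hμ : μ (Iic 0) = 0) :
    AntitoneOn (radialPotential μ) (Ioi 0) := fun _ hr _ hr' h =>
  integral_mono_ae (integrable_radialHeatKernel hμ hr') (integrable_radialHeatKernel hμ hr)
    ((ae_pos_of_Iic_zero hμ).mono fun _ hs => radialHeatKernel_antitone hs (le_of_lt hr) h)

lemma radialPotential_le_inv_cube (hμ : μ (Iic 0) = 0) {r : ℝ} (hr : 0 < r) :
    radialPotential μ r ≤ 3 ^ (3 / 2 : ℝ) * (r ^ 3)⁻¹ := by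
  calc radialPotential μ r ≤ ∫ _, 3 ^ (3 / 2 : ℝ) * (r ^ 3)⁻¹ ∂μ :=
        integral_mono_ae (integrable_radialHeatKernel hμ hr) (integrable_const _)
          ((ae_pos_of_Iic_zero hμ).mono fun s hs => radialHeatKernel_le_inv_cube hs hr)
    _ = _ := by simp

/-- Freezing the profile inside radius `r` gives a continuous function on the whole space that
vanishes at infinity, hence a uniformly continuous one. -/
lemma uniformContinuous_radialPotential_max (hμ : μ (Iic 0) = 0) {r : ℝ} (hr : 0 < r) :
    UniformContinuous fun x : E3 => radialPotential μ (max r ‖x‖) := by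
  have hpos : ∀ x : E3, 0 < max r ‖x‖ := fun x => lt_max_of_lt_left hr
  refine Continuous.uniformContinuous_of_tendsto_cocompact (x := 0) ?_ ?_
  · refine continuous_of_dominated (bound := fun s => radialHeatKernel s r)
      (fun x => (integrable_radialHeatKernel hμ (hpos x)).aestronglyMeasurable) (fun x => ?_)
      (integrable_radialHeatKernel hμ hr) (.of_forall fun s => ?_)
    · filter_upwards [ae_pos_of_Iic_zero hμ] with s hs
      rw [Real.norm_of_nonneg (radialHeatKernel_pos hs _).le]
      exact radialHeatKernel_antitone hs hr.le (le_max_left _ _)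
    · exact (continuous_radialHeatKernel s).comp (by fun_prop)
  · have h1 : Filter.Tendsto (fun x : E3 => max r ‖x‖) (Filter.cocompact E3) Filter.atTop :=
      Filter.tendsto_atTop_mono (fun x => le_max_right _ _) tendsto_norm_cocompact_atTop
    have h2 : Filter.Tendsto (fun ρ : ℝ => 3 ^ (3 / 2 : ℝ) * (ρ ^ 3)⁻¹) Filter.atTop (nhds 0) := by
      simpa using (tendsto_inv_atTop_zero.comp
        (Filter.tendsto_pow_atTop (α := ℝ) (n := 3) (by norm_num))).const_mul (3 ^ (3 / 2 : ℝ))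
    exact squeeze_zero (fun x => (radialPotential_pos hμ (hpos x)).le)
      (fun x => radialPotential_le_inv_cube hμ (hpos x)) (h2.comp h1)

lemma integrable_exp_neg_mul (hμ : μ (Iic 0) = 0) {q : ℝ} (hq : 0 ≤ q) :
    Integrable (fun s => Real.exp (-(q * s))) μ := by
  refine Integrable.of_bound (by fun_prop) 1 ((ae_pos_of_Iic_zero hμ).mono fun s hs => ?_)
  rw [Real.norm_of_nonneg (by positivity), Real.exp_le_one_iff, neg_nonpos]
  positivity

lemma laplaceIntegral_pos (hμ : μ (Iic 0) = 0) {q : ℝ} (hq : 0 ≤ q) :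
    0 < laplaceIntegral μ q :=
  integral_pos_of_ae_pos (.of_forall fun _ => Real.exp_pos _) (integrable_exp_neg_mul hμ hq)

lemma laplaceIntegral_anti (hμ : μ (Iic 0) = 0) {q R : ℝ} (hq : 0 ≤ q) (h : q ≤ R) :
    laplaceIntegral μ R ≤ laplaceIntegral μ q :=
  integral_mono_ae (integrable_exp_neg_mul hμ (hq.trans h)) (integrable_exp_neg_mul hμ hq)
    ((ae_pos_of_Iic_zero hμ).mono fun s hs => by
      rw [Real.exp_le_exp, neg_le_neg_iff]
      gcongr)

lemma laplaceIntegral_le_one (hμ : μ (Iic 0) = 0) {q : ℝ} (hq : 0 ≤ q) :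
    laplaceIntegral μ q ≤ 1 := by
  refine (laplaceIntegral_anti hμ le_rfl hq).trans ?_
  simp [laplaceIntegral]

lemma measurable_laplaceIntegral : Measurable (laplaceIntegral μ) := by
  refine StronglyMeasurable.measurable (StronglyMeasurable.integral_prod_right
    (f := fun q s : ℝ => Real.exp (-(q * s))) ?_)
  exact Measurable.stronglyMeasurable (by fun_prop)

lemma exists_le_radialPotential (hμ : μ (Iic 0) = 0) {M : ℝ} (hM : 1 < M) :
    ∃ c : ℝ, 0 < c ∧ ∀ r : ℝ, 0 < r → c * ((r ^ 3)⁻¹ *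
      (laplaceIntegral μ (r ^ 2)⁻¹ - 2 * laplaceIntegral μ (M * (r ^ 2)⁻¹))) ≤
        radialPotential μ r := by
  obtain ⟨c, hc, h⟩ := exists_mul_exp_sub_le M hM
  refine ⟨c, hc, fun r hr => ?_⟩
  have hi1 := integrable_exp_neg_mul hμ (q := (r ^ 2)⁻¹) (by positivity)
  have hi2 := integrable_exp_neg_mul hμ (q := M * (r ^ 2)⁻¹) (by positivity)
  rw [laplaceIntegral, laplaceIntegral, ← integral_const_mul 2,
    ← integral_sub hi1 (hi2.const_mul 2), ← integral_const_mul, ← integral_const_mul]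
  refine integral_mono_ae (((hi1.sub (hi2.const_mul 2)).const_mul _).const_mul _)
    (integrable_radialHeatKernel hμ hr) ((ae_pos_of_Iic_zero hμ).mono fun s hs => ?_)
  dsimp only
  rw [radialHeatKernel_scale hs hr, mul_left_comm]
  refine mul_le_mul_of_nonneg_left ?_ (by positivity)
  have := h ((r ^ 2)⁻¹ * s) (by positivity)
  rwa [← mul_assoc M] at this

lemma integral_rpow_mul_exp_neg_mul {a r : ℝ} (ha : 0 < a) (hr : 0 < r) :
    ∫ t in Ioi (0 : ℝ), t ^ (a - 1) * Real.exp (-(r * t)) = r ^ (-a) * Real.Gamma a := by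
  rw [Real.integral_rpow_mul_exp_neg_mul_Ioi ha hr, one_div, Real.inv_rpow hr.le,
    Real.rpow_neg hr.le]

lemma integrableOn_rpow_mul_exp_neg_mul {a r : ℝ} (ha : 0 < a) (hr : 0 < r) :
    IntegrableOn (fun t => t ^ (a - 1) * Real.exp (-(r * t))) (Ioi 0) := by
  refine Integrable.of_integral_ne_zero ?_
  rw [integral_rpow_mul_exp_neg_mul ha hr]
  have := Real.Gamma_pos_of_pos ha
  positivity

/-- Writes `Γ(3/2) (s + r²)^(-3/2)` as `∫ q^(1/2) e^(-(s + r²) q) dq` and applies Fubini. -/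
lemma radialPotential_le_integral (hμ : μ (Iic 0) = 0) {r : ℝ} (hr : 0 < r) :
    radialPotential μ r ≤ 3 ^ (3 / 2 : ℝ) * (Real.Gamma (3 / 2))⁻¹ *
      ∫ q in Ioi (0 : ℝ), q ^ ((3 / 2 : ℝ) - 1) * Real.exp (-(r ^ 2 * q)) *
        laplaceIntegral μ q := by
  have hΓ : 0 < Real.Gamma (3 / 2) := Real.Gamma_pos_of_pos (by norm_num)
  have hr2 : 0 < r ^ 2 := by positivity
  have hint := integrableOn_rpow_mul_exp_neg_mul (a := 3 / 2) (by norm_num) hr2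
  have hprod : Integrable (fun p : ℝ × ℝ => p.1 ^ ((3 / 2 : ℝ) - 1) * Real.exp (-(r ^ 2 * p.1)) *
      Real.exp (-(p.1 * p.2))) ((volume.restrict (Ioi 0)).prod μ) := by
    refine (hint.mul_prod (integrable_const (1 : ℝ))).mono (by fun_prop) ?_
    have h1 : ∀ᵐ p ∂(((volume : Measure ℝ).restrict (Ioi 0)).prod μ), 0 < p.1 :=
      Measure.quasiMeasurePreserving_fst.ae (ae_restrict_mem measurableSet_Ioi)
    have h2 : ∀ᵐ p ∂(((volume : Measure ℝ).restrict (Ioi 0)).prod μ), 0 < p.2 :=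
      Measure.quasiMeasurePreserving_snd.ae (ae_pos_of_Iic_zero hμ)
    filter_upwards [h1, h2] with p hp1 hp2
    rw [norm_mul, norm_mul _ (1 : ℝ)]
    refine mul_le_mul_of_nonneg_left ?_ (norm_nonneg _)
    rw [norm_one, Real.norm_of_nonneg (by positivity), Real.exp_le_one_iff, neg_nonpos]
    positivity
  have hswap := integral_integral_swap (f := fun q s : ℝ =>
    q ^ ((3 / 2 : ℝ) - 1) * Real.exp (-(r ^ 2 * q)) * Real.exp (-(q * s))) hprod
  have hin : ∀ s : ℝ, 0 < s → ∫ q in Ioi (0 : ℝ), q ^ ((3 / 2 : ℝ) - 1) *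
      Real.exp (-(r ^ 2 * q)) * Real.exp (-(q * s)) =
        (s + r ^ 2) ^ (-(3 / 2) : ℝ) * Real.Gamma (3 / 2) := by
    intro s hs
    rw [← integral_rpow_mul_exp_neg_mul (by norm_num) (by positivity)]
    refine integral_congr_ae (.of_forall fun q => ?_)
    dsimp only
    rw [mul_assoc, ← Real.exp_add]
    ring_nf
  simp only [integral_const_mul] at hswap
  unfold laplaceIntegral
  rw [hswap, ← integral_const_mul]
  refine integral_mono_ae (integrable_radialHeatKernel hμ hr)
    (hprod.integral_prod_right.const_mul _) ((ae_pos_of_Iic_zero hμ).mono fun s hs => ?_)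
  dsimp only
  rw [hin s hs]
  refine (radialHeatKernel_le hs r).trans (le_of_eq ?_)
  field_simp

/-- An upper bound for the potential at `r` by the Laplace transform at `r⁻²`. -/
lemma exists_radialPotential_le (hμ : μ (Iic 0) = 0)
    (hG : ∀ q R, 0 < q → q ≤ R → laplaceIntegral μ q ≤ R / q * laplaceIntegral μ R) :
    ∃ C : ℝ, 0 < C ∧ ∀ r : ℝ, 0 < r →
      radialPotential μ r ≤ C * ((r ^ 3)⁻¹ * laplaceIntegral μ (r ^ 2)⁻¹) := by
  have hΓ : 0 < Real.Gamma (3 / 2) := Real.Gamma_pos_of_pos (by norm_num)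
  have hΓ' : 0 < Real.Gamma (1 / 2) := Real.Gamma_pos_of_pos (by norm_num)
  refine ⟨3 ^ (3 / 2 : ℝ) * (Real.Gamma (3 / 2))⁻¹ * (Real.Gamma (3 / 2) + Real.Gamma (1 / 2)),
    by positivity, fun r hr => (radialPotential_le_integral hμ hr).trans ?_⟩
  have hr2 : 0 < r ^ 2 := by positivity
  set R := (r ^ 2)⁻¹ with hR
  have hR0 : 0 < R := by positivity
  have hGR : 0 < laplaceIntegral μ R := laplaceIntegral_pos hμ hR0.le
  have hint1 := integrableOn_rpow_mul_exp_neg_mul (a := 3 / 2) (by norm_num) hr2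
  have hint2 := integrableOn_rpow_mul_exp_neg_mul (a := 1 / 2) (by norm_num) hr2
  -- Left of `R` this is the growth hypothesis, right of `R` monotonicity; the two summands produce
  -- `Γ(3/2)` and `Γ(1/2)`.
  have hbound : ∀ q : ℝ, 0 < q → laplaceIntegral μ q ≤ (1 + R / q) * laplaceIntegral μ R := by
    intro q hq
    rcases le_total q R with h | h
    · refine (hG q R hq h).trans ?_
      gcongr
      linarith
    · refine (laplaceIntegral_anti hμ hR0.le h).trans (le_mul_of_one_le_left hGR.le ?_)
      have : 0 ≤ R / q := by positivity
      linarith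
  rw [mul_assoc (3 ^ (3 / 2 : ℝ) * (Real.Gamma (3 / 2))⁻¹)]
  refine mul_le_mul_of_nonneg_left ?_ (by positivity)
  calc ∫ q in Ioi (0 : ℝ), q ^ ((3 / 2 : ℝ) - 1) * Real.exp (-(r ^ 2 * q)) * laplaceIntegral μ q
      ≤ ∫ q in Ioi (0 : ℝ), (laplaceIntegral μ R *
          (q ^ ((3 / 2 : ℝ) - 1) * Real.exp (-(r ^ 2 * q))) +
          laplaceIntegral μ R * R * (q ^ ((1 / 2 : ℝ) - 1) * Real.exp (-(r ^ 2 * q)))) := by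
        refine integral_mono_of_nonneg ?_ ((hint1.const_mul _).add (hint2.const_mul _)) ?_
        · filter_upwards [ae_restrict_mem measurableSet_Ioi] with q hq
          have hq : 0 < q := hq
          have := laplaceIntegral_pos hμ hq.le
          dsimp only [Pi.zero_apply]
          positivity
        · filter_upwards [ae_restrict_mem measurableSet_Ioi] with q hq
          have hq : 0 < q := hq
          have h1 : q ^ ((1 / 2 : ℝ) - 1) = q ^ ((3 / 2 : ℝ) - 1) / q := by
            rw [← Real.rpow_sub_one hq.ne']; norm_num
          rw [h1]
          calc q ^ ((3 / 2 : ℝ) - 1) * Real.exp (-(r ^ 2 * q)) * laplaceIntegral μ q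
              ≤ q ^ ((3 / 2 : ℝ) - 1) * Real.exp (-(r ^ 2 * q)) *
                ((1 + R / q) * laplaceIntegral μ R) := by
                gcongr
                exact hbound q hq
            _ = _ := by ring
    _ = _ := by
        rw [integral_add (hint1.const_mul _) (hint2.const_mul _), integral_const_mul,
          integral_const_mul, integral_rpow_mul_exp_neg_mul (by norm_num) hr2,
          integral_rpow_mul_exp_neg_mul (by norm_num) hr2, sq_rpow_neg_three_half hr]
        have h2 : (r ^ 2) ^ (-(1 / 2) : ℝ) = r⁻¹ := by
          rw [← Real.rpow_natCast, ← Real.rpow_mul hr.le, ← Real.rpow_neg_one]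
          norm_num
        rw [h2, hR]
        field_simp

end

/-! ### Integrability, Fourier transform and positive definiteness -/

section
variable {μ : Measure ℝ} [IsProbabilityMeasure μ]

lemma integrable_heatKernel_prod (hμ : μ (Iic 0) = 0) :
    Integrable (fun p : E3 × ℝ => heatKernel p.2 p.1) (volume.prod μ) := by
  have hm : Measurable fun p : E3 × ℝ => heatKernel p.2 p.1 :=
    measurable_radialHeatKernel.comp (f := fun p : E3 × ℝ => (p.2, ‖p.1‖)) (by fun_prop)
  have hpos := ae_pos_of_Iic_zero hμ
  refine (integrable_prod_iff' hm.aestronglyMeasurable).2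
    ⟨hpos.mono fun s hs => integrable_heatKernel hs, ?_⟩
  refine (integrable_const (1 : ℝ)).congr (hpos.mono fun s hs => ?_)
  dsimp only
  rw [← integral_heatKernel hs]
  congr with x
  exact (Real.norm_of_nonneg (radialHeatKernel_pos hs _).le).symm

lemma integrable_radialPotential_norm (hμ : μ (Iic 0) = 0) :
    Integrable fun x : E3 => radialPotential μ ‖x‖ :=
  (integrable_heatKernel_prod hμ).integral_prod_left

lemma fourierR3_radialPotential (hμ : μ (Iic 0) = 0) (z : E3) :
    fourierR3 (fun x => radialPotential μ ‖x‖) z = (laplaceIntegral μ (‖z‖ ^ 2 / 2) : ℂ) := by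
  have hi : Integrable (fun p : E3 × ℝ => Complex.exp (Complex.I * ((inner ℝ p.1 z : ℝ) : ℂ)) *
      (heatKernel p.2 p.1 : ℂ)) (volume.prod μ) := by
    refine (integrable_heatKernel_prod hμ).ofReal.bdd_mul (c := 1) (by fun_prop)
      (.of_forall fun p => ?_)
    rw [mul_comm, Complex.norm_exp_ofReal_mul_I]
  have hswap := integral_integral_swap (f := fun (x : E3) (s : ℝ) =>
    Complex.exp (Complex.I * ((inner ℝ x z : ℝ) : ℂ)) * (heatKernel s x : ℂ)) hi
  simp only [integral_const_mul, integral_complex_ofReal] at hswap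
  rw [fourierR3]
  refine hswap.trans ?_
  rw [laplaceIntegral, ← integral_complex_ofReal]
  exact integral_congr_ae ((ae_pos_of_Iic_zero hμ).mono fun s hs => fourier_heatKernel hs z)

end

/-- Fubini moves the Fourier transform from the test function to `f`, so the pairing is `∫ g ψ`. -/
lemma isCorrelationFunction_of_integrable {f : E3 → ℝ} (hpos : ∀ x, 0 < f x)
    (hf : Integrable f) {g : E3 → ℝ} (hg : ∀ z, 0 ≤ g z) (hfg : ∀ z, fourierR3 f z = (g z : ℂ)) :
    IsCorrelationFunction f := by
  have hi : ∀ ψ : SchwartzMap E3 ℝ, Integrable (fun p : E3 × E3 => (f p.1 : ℂ) *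
      (Complex.exp (Complex.I * ((inner ℝ p.2 p.1 : ℝ) : ℂ)) * (ψ p.2 : ℂ)))
      (volume.prod volume) := by
    intro ψ
    refine ((hf.ofReal (𝕜 := ℂ)).mul_prod (ψ.integrable.ofReal (𝕜 := ℂ))).bdd_mul (c := 1)
      (f := fun p : E3 × E3 => Complex.exp (Complex.I * ((inner ℝ p.2 p.1 : ℝ) : ℂ)))
      (by fun_prop) (.of_forall fun p => ?_) |>.congr (.of_forall fun p => ?_)
    · rw [mul_comm, Complex.norm_exp_ofReal_mul_I]
    · simp only [Complex.coe_algebraMap]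
      ring
  have key : ∀ ψ : SchwartzMap E3 ℝ, ∫ x, (f x : ℂ) * fourierR3 ψ x =
      ((∫ u, g u * ψ u : ℝ) : ℂ) := by
    intro ψ
    have hswap := integral_integral_swap (f := fun x u : E3 => (f x : ℂ) *
      (Complex.exp (Complex.I * ((inner ℝ u x : ℝ) : ℂ)) * (ψ u : ℂ))) (hi ψ)
    simp only [integral_const_mul] at hswap
    refine hswap.trans ?_
    rw [← integral_complex_ofReal]
    congr with u
    rw [Complex.ofReal_mul, ← hfg, fourierR3, ← integral_mul_const]
    congr with x
    rw [real_inner_comm]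
    ring
  refine ⟨hpos, hf.locallyIntegrable, fun ψ => ?_, fun ψ hψ => ?_⟩
  · refine (hi ψ).integral_prod_left.congr (.of_forall fun x => ?_)
    simp only [integral_const_mul]
    rfl
  · rw [key ψ]
    refine ⟨Complex.ofReal_im _, ?_⟩
    rw [Complex.ofReal_re]
    exact integral_nonneg fun u => mul_nonneg (hg u) (hψ u)

/-! ### Dalang's condition and the comparison functions -/

lemma asympOn_of_le {R : Type*} {S : Set R} {A B : R → ℝ} {c₁ c₂ : ℝ} (h₁ : 0 < c₁) (h₂ : 0 < c₂)
    (hB : ∀ r ∈ S, 0 ≤ B r) (hl : ∀ r ∈ S, c₁ * B r ≤ A r) (hu : ∀ r ∈ S, A r ≤ c₂ * B r) :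
    AsympOn S A B := by
  refine ⟨⟨c₁⁻¹ + 1, by have := inv_pos.2 h₁; linarith, fun r hr => ?_⟩,
    ⟨c₂ + 1, by linarith, fun r hr => ?_⟩⟩
  · have h1 : B r ≤ c₁⁻¹ * A r := by
      rw [← div_eq_inv_mul, le_div_iff₀ h₁, mul_comm]; exact hl r hr
    have h2 : 0 ≤ A r := (mul_nonneg h₁.le (hB r hr)).trans (hl r hr)
    linarith
  · have := hu r hr
    have := hB r hr
    linarith

/-- The antiderivative `-(log r)^(1 - α) / (α - 1)` vanishes at infinity exactly because `α > 1`. -/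
lemma integrableOn_inv_mul_log_rpow {α : ℝ} (hα : 1 < α) :
    IntegrableOn (fun r : ℝ => r⁻¹ * Real.log r ^ (-α)) (Ioi (Real.exp 1)) := by
  have hlog : ∀ r ∈ Ici (Real.exp 1), 0 < r ∧ 1 ≤ Real.log r := fun r hr => by
    have h0 : 0 < r := (Real.exp_pos 1).trans_le hr
    exact ⟨h0, (Real.le_log_iff_exp_le h0).2 hr⟩
  refine integrableOn_Ioi_deriv_of_nonneg' (g := fun r => -(α - 1)⁻¹ * Real.log r ^ (1 - α))
    (l := -(α - 1)⁻¹ * 0) (fun r hr => ?_) (fun r hr => ?_) ?_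
  · obtain ⟨h0, h1⟩ := hlog r hr
    have h := ((Real.hasDerivAt_log h0.ne').rpow_const (p := 1 - α)
      (Or.inl (by linarith))).const_mul (-(α - 1)⁻¹)
    have hα1 : α - 1 ≠ 0 := by linarith
    have heq : -(α - 1)⁻¹ * (r⁻¹ * (1 - α) * Real.log r ^ (1 - α - 1)) =
        r⁻¹ * Real.log r ^ (-α) := by
      rw [show 1 - α - 1 = -α by ring]
      field_simp
      ring
    rwa [heq] at h
  · obtain ⟨h0, h1⟩ := hlog r (mem_Ici.2 (le_of_lt hr))
    have : 0 < Real.log r := by linarith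
    positivity
  · refine Filter.Tendsto.const_mul _ ?_
    have := (tendsto_rpow_neg_atTop (y := α - 1) (by linarith)).comp Real.tendsto_log_atTop
    simpa [Function.comp_def] using this

/-- In polar coordinates the factor `r² / (1 + r²)` is at most `1`, so integrability of `g` on the
half line is enough. -/
lemma integrable_div_one_add_norm_sq {g : ℝ → ℝ} {α C : ℝ} (hα : 1 < α) (hm : Measurable g)
    (h0 : ∀ r, 0 ≤ r → 0 ≤ g r) (h1 : ∀ r, 0 ≤ r → g r ≤ 1)
    (h2 : ∀ r, Real.exp 1 ≤ r → g r ≤ C * (r⁻¹ * Real.log r ^ (-α))) :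
    Integrable fun z : E3 => g ‖z‖ / (1 + ‖z‖ ^ 2) := by
  rw [integrable_fun_norm_addHaar (volume : Measure E3) (f := fun r => g r / (1 + r ^ 2)),
    finrank_euclideanSpace, Fintype.card_fin]
  have he := Real.exp_pos 1
  have hle : ∀ r : ℝ, 0 ≤ r → ‖r ^ (3 - 1) • (g r / (1 + r ^ 2))‖ ≤ g r := by
    intro r hr
    have := h0 r hr
    rw [Real.norm_of_nonneg (by rw [smul_eq_mul]; positivity), smul_eq_mul, mul_div_assoc']
    refine div_le_of_le_mul₀ (by positivity) this ?_
    norm_num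
    nlinarith
  have hmeas : Measurable fun r : ℝ => r ^ (3 - 1) • (g r / (1 + r ^ 2)) := by fun_prop
  rw [← Ioc_union_Ioi_eq_Ioi he.le]
  refine IntegrableOn.union ?_ ?_
  · refine IntegrableOn.of_bound (by simp) hmeas.aestronglyMeasurable 1 ?_
    filter_upwards [ae_restrict_mem measurableSet_Ioc] with r hr
    exact (hle r hr.1.le).trans (h1 r hr.1.le)
  · refine ((integrableOn_inv_mul_log_rpow hα).const_mul C).mono' hmeas.aestronglyMeasurable ?_
    filter_upwards [ae_restrict_mem measurableSet_Ioi] with r hr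
    have hr : Real.exp 1 < r := hr
    exact (hle r (he.trans hr).le).trans (h2 r hr.le)

/-- Brings `r⁻²` for `r < 1/e` and `r² / 2` for `r ≥ e` into the range `q ≥ 3` of
`laplaceExponent_asymp`. -/
lemma exp_two_ge : 7 ≤ Real.exp 1 ^ 2 := by
  have := Real.exp_one_gt_d9
  nlinarith

lemma three_le_inv_sq {r : ℝ} (hr : 0 < r) (h : r < Real.exp (-1)) : 3 ≤ (r ^ 2)⁻¹ := by
  have h1 : r ^ 2 ≤ Real.exp (-1) ^ 2 := by gcongr
  rw [Real.exp_neg, inv_pow] at h1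
  have h2 := exp_two_ge
  calc (3 : ℝ) ≤ Real.exp 1 ^ 2 := by linarith
    _ ≤ (r ^ 2)⁻¹ := by rwa [le_inv_comm₀ (by positivity) (by positivity)]

lemma inv_cube_mul_inv_asymp {r α : ℝ} (hr : 0 < r) (h : r < Real.exp (-1)) :
    (r ^ 3)⁻¹ * (√(r ^ 2)⁻¹ * Real.log (r ^ 2)⁻¹ ^ α)⁻¹ =
      2 ^ (-α) * (r ^ (-2 : ℝ) * Real.log (1 / r) ^ (-α)) := by
  have hl : 0 < Real.log (1 / r) := by
    rw [one_div, Real.log_inv]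
    have := Real.log_lt_log hr h
    rw [Real.log_exp] at this
    linarith
  have h1 : Real.log (r ^ 2)⁻¹ = 2 * Real.log (1 / r) := by
    rw [one_div, Real.log_inv, Real.log_inv, Real.log_pow]
    push_cast
    ring
  rw [h1, Real.sqrt_inv, Real.sqrt_sq hr.le, Real.mul_rpow (by norm_num) hl.le,
    Real.rpow_neg (by norm_num), Real.rpow_neg hr.le, Real.rpow_neg hl.le]
  norm_num
  field_simp

lemma sqrt_half_sq_asymp {r α : ℝ} (hα : 0 < α) (hr : Real.exp 1 ≤ r) :
    2⁻¹ * (r * Real.log r ^ α) ≤ √(r ^ 2 / 2) * Real.log (r ^ 2 / 2) ^ α ∧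
      √(r ^ 2 / 2) * Real.log (r ^ 2 / 2) ^ α ≤ 2 ^ α * (r * Real.log r ^ α) := by
  have hr0 : 0 < r := (Real.exp_pos 1).trans_le hr
  have hl : 1 ≤ Real.log r := (Real.le_log_iff_exp_le hr0).2 hr
  have hl2 : Real.log (r ^ 2 / 2) = 2 * Real.log r - Real.log 2 := by
    rw [Real.log_div (by positivity) (by norm_num), Real.log_pow]
    push_cast
    ring
  have h20 : 0 < Real.log 2 := Real.log_pos (by norm_num)
  have h21 : Real.log 2 ≤ 1 := by have := Real.log_two_lt_d9; linarith
  have hlow : Real.log r ≤ Real.log (r ^ 2 / 2) := by linarith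
  have hup : Real.log (r ^ 2 / 2) ≤ 2 * Real.log r := by linarith
  have hs1 : 2⁻¹ * r ≤ √(r ^ 2 / 2) := Real.le_sqrt_of_sq_le (by nlinarith)
  have hs2 : √(r ^ 2 / 2) ≤ r := Real.sqrt_le_iff.2 ⟨hr0.le, by nlinarith⟩
  have hlq : 0 ≤ Real.log (r ^ 2 / 2) := by linarith
  constructor
  · rw [← mul_assoc]
    gcongr
  · calc √(r ^ 2 / 2) * Real.log (r ^ 2 / 2) ^ α ≤ r * (2 * Real.log r) ^ α := by gcongr
      _ = _ := by rw [Real.mul_rpow (by norm_num) (by linarith)]; ring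

/-! ### Assembly -/

theorem mainTheorem4 (α : ℝ) (hα : 1 < α) :
    ∃ f : E3 → ℝ, IsCorrelationFunction f ∧
      -- `f` is integrable, so that its Fourier transform is given by the absolutely
      -- convergent integral; `f` and its Fourier transform are strictly positive
      Integrable f volume ∧
      (∀ x, 0 < f x) ∧
      (∀ z, (fourierR3 f z).im = 0 ∧ 0 < (fourierR3 f z).re) ∧
      -- uniform continuity away from the origin
      (∀ r : ℝ, 0 < r → UniformContinuousOn f (Metric.ball 0 r)ᶜ) ∧
      -- `f` is radial and nonincreasing
      (∃ φ : ℝ → ℝ, (∀ r, 0 ≤ r → 0 ≤ φ r) ∧ AntitoneOn φ (Ioi 0) ∧ ∀ x, f x = φ ‖x‖) ∧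
      -- behavior of `f` near the origin
      AsympOn (Metric.ball (0 : E3) (Real.exp (-1)) \ {0}) f
        (fun x => ‖x‖ ^ (-2 : ℝ) * (Real.log (1 / ‖x‖)) ^ (-α)) ∧
      -- behavior of the Fourier transform near infinity
      AsympOn (Metric.ball (0 : E3) (Real.exp 1))ᶜ (fun z => (fourierR3 f z).re)
        (fun z => ‖z‖⁻¹ * (Real.log ‖z‖) ^ (-α)) ∧
      -- Dalang's condition
      Integrable (fun z : E3 => (fourierR3 f z).re / (1 + ‖z‖ ^ 2)) volume ∧
      -- `f = ∫ p_s U(ds)`, where `U` is the 1-potential measure of a subordinator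
      ∃ (Ω : Type) (_ : MeasurableSpace Ω) (P : Measure Ω) (T : ℝ≥0 → Ω → ℝ) (U : Measure ℝ),
        IsProbabilityMeasure P ∧ IsSubordinator P T ∧ IsOnePotentialMeasure P T U ∧
        ∀ x : E3, x ≠ 0 →
          IntegrableOn (fun s => heatKernel s x) (Ioi 0) U ∧
          f x = ∫ s in Ioi 0, heatKernel s x ∂U := by
  have hα0 : 0 < α := by linarith
  have hs := summable_jumpRate_mul_jumpSize α
  set U := jumpPotential jumpSize (jumpRate α) with hU
  set Φ := laplaceExponent jumpSize (jumpRate α) with hΦ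
  have hU0 : U (Iic 0) = 0 := jumpPotential_Iic_zero α hα0
  have hG : ∀ q, 0 ≤ q → laplaceIntegral U q = (1 + Φ q)⁻¹ := fun q hq =>
    integral_exp_neg_jumpPotential jumpSize_pos hs hq
  have hΦ0 : ∀ q, 0 ≤ q → 0 ≤ Φ q := fun q hq => laplaceExponent_nonneg jumpSize_pos hq
  obtain ⟨c₁, c₂, hc₁, hc₂, hasymp⟩ := laplaceExponent_asymp α hα0
  obtain ⟨M, hM, hdil⟩ := exists_laplaceExponent_dilate α hα0
  have hGasymp : ∀ q, 3 ≤ q → c₂⁻¹ * (√q * Real.log q ^ α)⁻¹ ≤ laplaceIntegral U q ∧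
      laplaceIntegral U q ≤ c₁⁻¹ * (√q * Real.log q ^ α)⁻¹ := by
    intro q hq
    have hq0 : 0 ≤ q := by linarith
    have h1 := hΦ0 q hq0
    have hl : 0 < Real.log q := Real.log_pos (by linarith)
    rw [hG q hq0, ← mul_inv, ← mul_inv]
    exact ⟨inv_anti₀ (by positivity) (hasymp q hq).2, inv_anti₀ (by positivity) (hasymp q hq).1⟩
  obtain ⟨C, hC, hup⟩ := exists_radialPotential_le hU0 (fun q R hq hqR => by
    have h1 := hΦ0 q hq.le
    have h2 := hΦ0 R (hq.le.trans hqR)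
    have h3 : 1 ≤ R / q := (one_le_div hq).2 hqR
    have h4 : Φ R ≤ R / q * Φ q := laplaceExponent_le_div_mul jumpSize_pos hs hq hqR
    rw [hG q hq.le, hG R (hq.le.trans hqR), ← div_eq_mul_inv, le_div_iff₀ (by positivity),
      inv_mul_le_iff₀ (by positivity)]
    nlinarith)
  obtain ⟨c, hc, hlow⟩ := exists_le_radialPotential hU0 hM
  -- The integral diverges at `r = 0` and would default to `0`; the value `1` keeps `f` positive
  -- there, and monotonicity is only claimed on `(0, ∞)`.
  set φ : ℝ → ℝ := fun r => if r = 0 then 1 else radialPotential U r with hφ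
  have hφr : ∀ r, r ≠ 0 → φ r = radialPotential U r := fun r hr => if_neg hr
  have hφpos : ∀ r, 0 ≤ r → 0 < φ r := fun r hr => by
    rcases hr.eq_or_lt with h | h
    · simp [hφ, ← h]
    · rw [hφr r h.ne']; exact radialPotential_pos hU0 h
  have hae : (fun x : E3 => radialPotential U ‖x‖) =ᵐ[volume] fun x => φ ‖x‖ := by
    filter_upwards [compl_mem_ae_iff.2 (measure_singleton (0 : E3))] with x hx
    exact (hφr _ (norm_ne_zero_iff.2 hx)).symm
  have hint : Integrable fun x : E3 => φ ‖x‖ := (integrable_radialPotential_norm hU0).congr hae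
  have hfourier : ∀ z, fourierR3 (fun x => φ ‖x‖) z = (laplaceIntegral U (‖z‖ ^ 2 / 2) : ℂ) := by
    intro z
    rw [← fourierR3_radialPotential hU0 z, fourierR3, fourierR3]
    refine integral_congr_ae (hae.mono fun x hx => ?_)
    simp only at hx ⊢
    rw [hx]
  have hre : ∀ z, (fourierR3 (fun x => φ ‖x‖) z).re = laplaceIntegral U (‖z‖ ^ 2 / 2) := fun z => by
    rw [hfourier, Complex.ofReal_re]
  have hfup : ∀ r, Real.exp 1 ≤ r →
      laplaceIntegral U (r ^ 2 / 2) ≤ (2 * c₁⁻¹) * (r⁻¹ * Real.log r ^ (-α)) ∧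
      ((2 ^ α)⁻¹ * c₂⁻¹) * (r⁻¹ * Real.log r ^ (-α)) ≤ laplaceIntegral U (r ^ 2 / 2) := by
    intro r hr
    have hr0 : 0 < r := (Real.exp_pos 1).trans_le hr
    have hl : 0 < Real.log r := zero_lt_one.trans_le ((Real.le_log_iff_exp_le hr0).2 hr)
    have hq : 3 ≤ r ^ 2 / 2 := by
      have := exp_two_ge
      have : Real.exp 1 ^ 2 ≤ r ^ 2 := by gcongr
      linarith
    have hlq : 0 < Real.log (r ^ 2 / 2) := Real.log_pos (by linarith)
    obtain ⟨h1, h2⟩ := sqrt_half_sq_asymp hα0 hr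
    obtain ⟨h3, h4⟩ := hGasymp _ hq
    rw [Real.rpow_neg hl.le, ← mul_inv]
    constructor
    · refine h4.trans ?_
      rw [mul_comm 2, mul_assoc]
      refine mul_le_mul_of_nonneg_left ?_ (by positivity)
      refine (inv_anti₀ (by positivity) h1).trans_eq ?_
      rw [mul_inv, inv_inv]
    · refine le_trans ?_ h3
      rw [mul_comm (2 ^ α)⁻¹, mul_assoc]
      refine mul_le_mul_of_nonneg_left ?_ (by positivity)
      rw [← mul_inv]
      exact inv_anti₀ (by positivity) h2
  refine ⟨fun x => φ ‖x‖, isCorrelationFunction_of_integrable (fun x => hφpos _ (norm_nonneg x))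
    hint (fun z => (laplaceIntegral_pos hU0 (by positivity)).le) hfourier, hint,
    fun x => hφpos _ (norm_nonneg x), fun z => ?_, fun r hr => ?_, ?_, ?_, ?_, ?_, ?_⟩
  · rw [hfourier]
    exact ⟨Complex.ofReal_im _, by
      rw [Complex.ofReal_re]; exact laplaceIntegral_pos hU0 (by positivity)⟩
  · refine ((uniformContinuous_radialPotential_max hU0 hr).uniformContinuousOn
      (s := (Metric.ball 0 r)ᶜ)).congr fun x hx => ?_
    have hx : r ≤ ‖x‖ := by simpa using hx
    simp only [max_eq_right hx]
    rw [hφr _ (hr.trans_le hx).ne']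
  · refine ⟨φ, fun r hr => (hφpos r hr).le, ?_, fun x => rfl⟩
    exact (radialPotential_antitoneOn hU0).congr fun r hr => (hφr r (ne_of_gt hr)).symm
  · have hr : ∀ x ∈ Metric.ball (0 : E3) (Real.exp (-1)) \ {0}, 0 < ‖x‖ ∧ ‖x‖ < Real.exp (-1) :=
      fun x hx => ⟨norm_pos_iff.2 hx.2, by simpa using hx.1⟩
    refine asympOn_of_le (c₁ := c * (1 / 2) * c₂⁻¹ * 2 ^ (-α)) (c₂ := C * c₁⁻¹ * 2 ^ (-α))
      (by positivity) (by positivity) (fun x hx => ?_) (fun x hx => ?_) (fun x hx => ?_)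
    · obtain ⟨h0, h1⟩ := hr x hx
      have : 0 ≤ Real.log (1 / ‖x‖) := Real.log_nonneg (by
        rw [one_le_div h0]
        exact h1.le.trans (Real.exp_le_one_iff.2 (by norm_num)))
      positivity
    · obtain ⟨h0, h1⟩ := hr x hx
      have h3 := three_le_inv_sq h0 h1
      have hq0 : 0 ≤ (‖x‖ ^ 2)⁻¹ := by positivity
      rw [hφr _ h0.ne', mul_assoc, ← inv_cube_mul_inv_asymp h0 h1]
      refine le_trans ?_ (hlow _ h0)
      -- Hence `L(q) - 2 L(M q) ≥ L(q) / 2` at `q = ‖x‖⁻²`, the origin of the factor `1 / 2` in the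
      -- lower constant.
      have h4 : laplaceIntegral U (M * (‖x‖ ^ 2)⁻¹) ≤ 1 / 4 * laplaceIntegral U (‖x‖ ^ 2)⁻¹ := by
        have h5 := hΦ0 _ hq0
        have h6 := inv_anti₀ (by positivity) (hdil _ h3)
        rw [hG _ hq0, hG _ (by positivity)]
        refine h6.trans_eq ?_
        rw [mul_inv, ← hΦ]
        norm_num
      have h7 := (hGasymp _ h3).1
      calc c * (1 / 2) * c₂⁻¹ * ((‖x‖ ^ 3)⁻¹ *
            (√(‖x‖ ^ 2)⁻¹ * Real.log (‖x‖ ^ 2)⁻¹ ^ α)⁻¹)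
          = c * ((‖x‖ ^ 3)⁻¹ * (1 / 2 * (c₂⁻¹ *
            (√(‖x‖ ^ 2)⁻¹ * Real.log (‖x‖ ^ 2)⁻¹ ^ α)⁻¹))) := by ring
        _ ≤ _ := by
          gcongr
          linarith
    · obtain ⟨h0, h1⟩ := hr x hx
      have h3 := three_le_inv_sq h0 h1
      rw [hφr _ h0.ne', mul_assoc, ← inv_cube_mul_inv_asymp h0 h1]
      refine (hup _ h0).trans ?_
      calc C * ((‖x‖ ^ 3)⁻¹ * laplaceIntegral U (‖x‖ ^ 2)⁻¹)
          ≤ C * ((‖x‖ ^ 3)⁻¹ * (c₁⁻¹ * (√(‖x‖ ^ 2)⁻¹ * Real.log (‖x‖ ^ 2)⁻¹ ^ α)⁻¹)) := by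
            gcongr
            exact (hGasymp _ h3).2
        _ = _ := by ring
  · have hr : ∀ z ∈ (Metric.ball (0 : E3) (Real.exp 1))ᶜ, Real.exp 1 ≤ ‖z‖ := fun z hz => by
      simpa using hz
    refine asympOn_of_le (c₁ := (2 ^ α)⁻¹ * c₂⁻¹) (c₂ := 2 * c₁⁻¹)
      (by positivity) (by positivity) (fun z hz => ?_) (fun z hz => ?_) (fun z hz => ?_)
    · have : 0 ≤ Real.log ‖z‖ := Real.log_nonneg
        ((Real.one_le_exp zero_le_one).trans (hr z hz))
      positivity
    · rw [hre]; exact (hfup _ (hr z hz)).2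
    · rw [hre]; exact (hfup _ (hr z hz)).1
  · simp_rw [hre]
    exact integrable_div_one_add_norm_sq (g := fun r => laplaceIntegral U (r ^ 2 / 2)) hα
      (measurable_laplaceIntegral.comp (by fun_prop))
      (fun r _ => (laplaceIntegral_pos hU0 (by positivity)).le)
      (fun r _ => laplaceIntegral_le_one hU0 (by positivity)) (fun r hr => (hfup r hr).1)
  · refine ⟨JumpSpace, inferInstance, jumpLaw (jumpRate α), fun t => jumpProcess jumpSize t, U,
      inferInstance, isSubordinator_jumpProcess jumpSize_pos hs,
      isOnePotentialMeasure_jumpPotential, fun x hx => ?_⟩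
    have hx0 : 0 < ‖x‖ := norm_pos_iff.2 hx
    refine ⟨(integrable_radialHeatKernel hU0 hx0).integrableOn, ?_⟩
    rw [Measure.restrict_eq_self_of_ae_mem (s := Ioi 0) (ae_pos_of_Iic_zero hU0)]
    exact hφr _ hx0.ne'

end
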